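/- \textbf{Setting.} Let $G$ be a compact Lie group or a finite group (more generally, a compact Hausdorff second countable topological group), with normalized Haar measure $dg$. Let $s\colon G\to\mathbb R$ be a bounded $L^2$ class function and $w=\exp(-s)$. A \emph{finite generalized $2$-complex with cyclic structure} consists of finite sets $V,E,F$ (vertices, edges, polygons), maps $\partial_+,\partial_-\colon E\to V$ (end point and starting point), and for each $f\in F$ an integer $N(f)\ge1$, edges $\partial_1f,\dots,\partial_{N(f)}f\in E$ and signs $\epsilon_1f,\dots,\epsilon_{N(f)}f\in\{\pm1\}$ such that, with $j+1$ understood cyclically modulo $N(f)$, $\partial_{-\epsilon_jf}\,\partial_jf=\partial_{\epsilon_{j+1}f}\,\partial_{j+1}f$ for all $1\le j\le N(f)$. The partition function is $$Z=\Bigl(\prod_{e\in E}\int_G dg_e\Bigr)\prod_{f\in F}w(g_f),\qquad g_f=g_{\partial_1f}^{\epsilon_1f}\cdots g_{\partial_{N(f)}f}^{\epsilon_{N(f)}f}.$$ Let $\mathrm{Irrep}$ contain exactly one unitary representative (on some $\mathbb C^d$) of each equivalence class of continuous finite-dimensional irreducible complex representations of $G$. For $\rho\in\mathrm{Irrep}$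 let $\chi^{(\rho)}$ be its character and $\hat w_\rho=\int_G\overline{\chi^{(\rho)}(g)}\,w(g)\,dg$ the coefficient of $\chi^{(\rho)}$ in the character expansion $w=\sum_\rho\hat w_\rho\chi^{(\rho)}$. For $e\in E$ let $e_\pm$ be the family of all pairs $(f,j)$ with $\partial_jf=e$ and $\epsilon_jf=\pm1$. The \emph{corner} $(f,j)$ of $f$ lies between the $j$-th and the (cyclically) next edge of $f$, at the vertex $\partial_{-\epsilon_jf}\,\partial_jf$. Thus each $(f,j)\in e_+\cup e_-$ has one corner of $f$ at $\partial_+e$ and one at $\partial_-e$: these are $(f,j-1)$ and $(f,j)$, respectively, if $\epsilon_jf=+1$, and $(f,j)$ and $(f,j-1)$ if $\epsilon_jf=-1$. (If no polygon passes twice through the same edge or vertex, then $e_\pm$ may be regarded as sets of polygons, and each polygon has exactly one corner at each vertex of its boundary.) For a labelling $\rho\colon F\to\mathrm{Irrep}$, $f\mapsto\rho_f$, and $e\in E$, let $\mathcal P_e$ be a basis of orthogonal $G$-invariant projectors onto the trivial components in a complete orthogonal decomposition of $$\Bigl(\bigotimes_{(f,j)\in e_+}\rho_f\Bigr)\otimes\Bigl(\bigotimes_{(f,j)\in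 e_-}\rho_f^*\Bigr),$$ that is, $P=w_P\langle w_P;\cdot\rangle$ for $P\in\mathcal P_e$, where the $w_P$ form an orthonormal basis of the subspace of $G$-invariant vectors. In the product of the standard bases of $V_{\rho_f}=\mathbb C^{\dim V_{\rho_f}}$ and of their dual bases, put $P^{m}=(w_P)_m$ and $P_{n}=\overline{(w_P)_n}$; the multi-indices $m,n$ have one entry for each $(f,j)\in e_+\cup e_-$. For $v\in V$ and a choice of $P^{(e)}\in\mathcal P_e$ for all $e\in E$, set $$C(v)=\sum_{n}\ \Bigl(\prod_{e\in E:\,\partial_+e=v}P^{(e)\,n|_{e,+}}\Bigr)\Bigl(\prod_{e\in E:\,\partial_-e=v}P^{(e)}_{\,n|_{e,-}}\Bigr),$$ where $n$ assigns an index $1\le n_c\le\dim V_{\rho_f}$ to each corner $c=(f,j)$ at $v$, and $n|_{e,\pm}$ assigns to each element of $e_+\cup e_-$ the index of its corner at $\partial_\pm e$. \textbf{Theorem.} For all choices of $\mathrm{Irrep}$ and of the $\mathcal P_e$ (which may depend on the labelling $\rho$), $$Z=\Bigl(\prod_{f\in F}\sum_{\rho_f\in\mathrm{Irrep}}\Bigr)\Bigl(\prod_{e\in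 E}\sum_{P^{(e)}\in\mathcal P_e}\Bigr)\Bigl(\prod_{f\in F}\hat w_{\rho_f}\Bigr)\Bigl(\prod_{v\in V}C(v)\Bigr)$$ in the following sense. (a) If the boundary of every polygon passes through at least one edge exactly once, then the right-hand side, read as an iterated series with one summation over $\rho_f\in\mathrm{Irrep}$ per polygon $f\in F$, taken in an arbitrary order of the polygons, converges to $Z$; each of the successive series is unconditionally convergent. (b) For an arbitrary finite generalized $2$-complex with cyclic structure, if $s$ is continuous and $\sum_{\rho\in\mathrm{Irrep}}|\hat w_\rho|\dim V_\rho<\infty$ (both are automatic if $G$ is finite), then the series over all labellings $\rho\colon F\to\mathrm{Irrep}$ converges unconditionally to $Z$. -/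

import Mathlib

open MeasureTheory

/-- A generalized `2`-complex with cyclic structure. The finiteness of the sets `V` (vertices),
`E` (edges), `F` (polygons) is assumed separately. `head`, `tail` are the maps `∂₊`, `∂₋`. The
edges in the boundary of `f` are `bdry f j` with relative orientation `sign f j`, where `j` runs
through `Fin (N f)`, that is, the numbering starts at `0`. -/
structure TwoComplex (V E F : Type*) where
  /-- end point of an edge, `∂₊` -/
  head : E → V
  /-- starting point of an edge, `∂₋` -/
  tail : E → V
  /-- number of edges in the boundary of a polygon -/
  N : F → ℕ
  N_pos : ∀ f, 0 < N f
  /-- the `j`-th edge in the boundary of a polygon -/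
  bdry : (f : F) → Fin (N f) → E
  /-- its orientation, `+1` or `-1` -/
  sign : (f : F) → Fin (N f) → ℤˣ
  /-- `∂_{-ε_j f} ∂_j f = ∂_{ε_{j+1} f} ∂_{j+1} f`, where `j + 1` is understood cyclically. -/
  cyclic : ∀ (f : F) (j : Fin (N f)),
    (if -sign f j = 1 then head (bdry f j) else tail (bdry f j)) =
      (if sign f (finRotate (N f) j) = 1 then head (bdry f (finRotate (N f) j))
        else tail (bdry f (finRotate (N f) j)))

namespace TwoComplex

variable {V E F : Type*} (K : TwoComplex V E F)

/-- The positions in the boundaries of the polygons. The position `(f, j)` stands both for the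
passage of the boundary of `f` through its `j`-th edge and for the corner of `f` that lies between
the `j`-th edge and the cyclically next one. -/
abbrev Position : Type _ := Σ f : F, Fin (K.N f)

/-- The edge that is traversed at a position. -/
def edge (c : K.Position) : E := K.bdry c.1 c.2

/-- The vertex `∂_{-ε_j f} ∂_j f` at which the corner `(f, j)` lies. -/
def cornerVertex (c : K.Position) : V :=
  if -K.sign c.1 c.2 = 1 then K.head (K.edge c) else K.tail (K.edge c)

/-- The corner of the polygon at the end point of the traversed edge. -/
def headCorner (c : K.Position) : K.Position :=
  ⟨c.1, if K.sign c.1 c.2 = 1 then (finRotate (K.N c.1)).symm c.2 else c.2⟩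

/-- The corner of the polygon at the starting point of the traversed edge. -/
def tailCorner (c : K.Position) : K.Position :=
  ⟨c.1, if K.sign c.1 c.2 = 1 then c.2 else (finRotate (K.N c.1)).symm c.2⟩

theorem cornerVertex_headCorner (c : K.Position) :
    K.cornerVertex (K.headCorner c) = K.head (K.edge c) := by
  obtain ⟨f, j⟩ := c
  rcases Int.units_eq_one_or (K.sign f j) with h | h
  · have := K.cyclic f ((finRotate (K.N f)).symm j)
    simp only [Equiv.apply_symm_apply, h, if_true] at this
    simpa [cornerVertex, headCorner, edge, h] using this
  · simp [cornerVertex, headCorner, edge, h]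

theorem cornerVertex_tailCorner (c : K.Position) :
    K.cornerVertex (K.tailCorner c) = K.tail (K.edge c) := by
  obtain ⟨f, j⟩ := c
  have h1 : ¬ ((-1 : ℤˣ) = 1) := by decide
  rcases Int.units_eq_one_or (K.sign f j) with h | h
  · simp [cornerVertex, tailCorner, edge, h, h1]
  · have := K.cyclic f ((finRotate (K.N f)).symm j)
    simp only [Equiv.apply_symm_apply, h, h1, if_false] at this
    simpa [cornerVertex, tailCorner, edge, h, h1] using this

/-- The passages of polygons through the edge `e`: the disjoint union of `e₊` (those with
sign `+1`) and `e₋` (those with sign `-1`), counted with multiplicity. -/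
abbrev Passage (e : E) : Type _ := {c : K.Position // K.edge c = e}

/-- The corners of polygons that lie at the vertex `v`. -/
abbrev CornerAt (v : V) : Type _ := {c : K.Position // K.cornerVertex c = v}

/-- The boundary of every polygon passes through at least one edge exactly once. -/
def EveryPolygonHasSimpleEdge : Prop :=
  ∀ f : F, ∃ j : Fin (K.N f), ∀ k : Fin (K.N f), K.bdry f k = K.bdry f j → k = j

/-- The cyclically ordered product `g_f` of the group elements along the boundary of `f`. -/
def holonomy {G : Type*} [Group G] (g : E → G) (f : F) : G :=
  (List.ofFn fun j : Fin (K.N f) => g (K.bdry f j) ^ ((K.sign f j : ℤˣ) : ℤ)).prod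

end TwoComplex

/-- The Boltzmann weight `w(g) = exp(-s(g))` of a local action `s`. -/
noncomputable def boltzmannWeight {G : Type*} (s : G → ℝ) (g : G) : ℝ := Real.exp (-s g)

/-- The partition function of lattice gauge theory; `μ` is the normalized Haar measure. -/
noncomputable def TwoComplex.partitionFunction {V E F G : Type*} [Fintype E] [Fintype F]
    (K : TwoComplex V E F) [Group G] [MeasurableSpace G] (μ : Measure G) (w : G → ℝ) : ℝ :=
  ∫ g : E → G, ∏ f, w (K.holonomy g f) ∂(Measure.pi fun _ : E => μ)

/-- The linear representation on `ℂ^d` given by a homomorphism into the unitary `d × d`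
matrices. -/
noncomputable def unitaryMatrixRep {G : Type*} [Group G] {d : ℕ}
    (m : G →* Matrix.unitaryGroup (Fin d) ℂ) : Representation ℂ G (Fin d → ℂ) :=
  ((Matrix.toLinAlgEquiv' : Matrix (Fin d) (Fin d) ℂ ≃ₐ[ℂ] _) :
      Matrix (Fin d) (Fin d) ℂ →* ((Fin d → ℂ) →ₗ[ℂ] (Fin d → ℂ))).comp
    ((Matrix.unitaryGroup (Fin d) ℂ).subtype.comp m)

/-- A finite-dimensional irreducible continuous unitary representation of `G`, written in an
orthonormal basis. -/
structure UnitaryIrrep (G : Type*) [Group G] [TopologicalSpace G] where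
  dim : ℕ
  mat : G →* Matrix.unitaryGroup (Fin dim) ℂ
  continuous_mat : Continuous mat
  irreducible : (unitaryMatrixRep mat).IsIrreducible

namespace UnitaryIrrep

variable {G : Type*} [Group G] [TopologicalSpace G]

/-- The matrix `t^{(ρ)}(g)` of representation functions. -/
def t (ρ : UnitaryIrrep G) (g : G) : Matrix (Fin ρ.dim) (Fin ρ.dim) ℂ := (ρ.mat g).1

/-- The matrix of the dual representation `ρ*(g) η = η ∘ ρ(g⁻¹)` in the dual basis. -/
def tDual (ρ : UnitaryIrrep G) (g : G) : Matrix (Fin ρ.dim) (Fin ρ.dim) ℂ :=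
  (ρ.t g⁻¹).transpose

/-- The character. -/
noncomputable def char (ρ : UnitaryIrrep G) (g : G) : ℂ := (ρ.t g).trace

/-- Equivalence of representations. -/
def Equivalent (ρ σ : UnitaryIrrep G) : Prop :=
  Nonempty (Representation.Equiv (unitaryMatrixRep ρ.mat) (unitaryMatrixRep σ.mat))

/-- The set `I` contains exactly one representative of each equivalence class. -/
def IsRepresentativeSet (I : Set (UnitaryIrrep G)) : Prop :=
  ∀ ρ : UnitaryIrrep G, ∃! σ : UnitaryIrrep G, σ ∈ I ∧ ρ.Equivalent σ

/-- The coefficient of `χ^{(ρ)}` in the character expansion of `w`. -/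
noncomputable def coeff [MeasurableSpace G] (μ : Measure G) (w : G → ℝ) (ρ : UnitaryIrrep G) : ℂ :=
  ∫ g, star (ρ.char g) * (w g : ℂ) ∂μ

end UnitaryIrrep

namespace TwoComplex

variable {V E F : Type*} (K : TwoComplex V E F) {G : Type*} [Group G] [TopologicalSpace G]

/-- Multi-indices for the product basis of `(⨂_{f ∈ e₊} V_{ρ_f}) ⊗ (⨂_{f ∈ e₋} V_{ρ_f}^*)`. -/
abbrev EdgeIndex (ρ : F → UnitaryIrrep G) (e : E) : Type _ :=
  (o : K.Passage e) → Fin (ρ o.1.1).dim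

variable [Fintype F] [DecidableEq F] [DecidableEq E]

/-- The vector space `(⨂_{f ∈ e₊} V_{ρ_f}) ⊗ (⨂_{f ∈ e₋} V_{ρ_f}^*)`, with its standard scalar
product, in coordinates with respect to the (orthonormal) product basis. -/
abbrev EdgeSpace (ρ : F → UnitaryIrrep G) (e : E) : Type _ :=
  EuclideanSpace ℂ (K.EdgeIndex ρ e)

/-- The matrix of `(⨂_{f ∈ e₊} ρ_f) ⊗ (⨂_{f ∈ e₋} ρ_f^*)` in the product basis. -/
noncomputable def edgeMatrix (ρ : F → UnitaryIrrep G) (e : E) (g : G) :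
    Matrix (K.EdgeIndex ρ e) (K.EdgeIndex ρ e) ℂ :=
  fun m n => ∏ o : K.Passage e,
    if K.sign o.1.1 o.1.2 = 1 then (ρ o.1.1).t g (m o) (n o) else (ρ o.1.1).tDual g (m o) (n o)

/-- The `G`-invariant vectors of the edge representation, that is, the sum of the trivial
components. An orthonormal basis `(w^{(j)})` of this space is the same as an orthogonal
decomposition into trivial components with a normalized vector in each of them; the projector onto
the `j`-th one is `P^{(j)} = w^{(j)} ⟨w^{(j)}; ·⟩`. -/
noncomputable def edgeInvariants (ρ : F → UnitaryIrrep G) (e : E) :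
    Submodule ℂ (K.EdgeSpace ρ e) :=
  ⨅ g : G, LinearMap.ker (Matrix.toEuclideanLin (K.edgeMatrix ρ e g) - LinearMap.id)

variable [Fintype V] [DecidableEq V] [Fintype E]

/-- The vertex weight `C(v)`, for normalized invariant vectors `x e` spanning the images of the
projectors `P^{(e)}`: the components are `P^{(e) m} = x e m` and `P^{(e)}_n = conj (x e n)`. One
index is summed for each corner of a polygon at `v`. -/
noncomputable def vertexWeight (ρ : F → UnitaryIrrep G) (x : (e : E) → K.EdgeSpace ρ e)
    (v : V) : ℂ :=
  ∑ n : ((c : K.CornerAt v) → Fin (ρ c.1.1).dim),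
    (∏ e : {e : E // K.head e = v},
      x e.1 (fun o : K.Passage e.1 => n ⟨K.headCorner o.1,
        (K.cornerVertex_headCorner o.1).trans ((congrArg K.head o.2).trans e.2)⟩)) *
    (∏ e : {e : E // K.tail e = v},
      star (x e.1 (fun o : K.Passage e.1 => n ⟨K.tailCorner o.1,
        (K.cornerVertex_tailCorner o.1).trans ((congrArg K.tail o.2).trans e.2)⟩)))

/-- A choice, for every labelling of the polygons by elements of `I` and every edge, of an
orthonormal basis of the space of invariant vectors. -/
abbrev ProjectorBases (I : Set (UnitaryIrrep G)) : Type _ :=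
  (ρ : F → I) → (e : E) →
    OrthonormalBasis (Fin (Module.finrank ℂ (K.edgeInvariants (fun f => (ρ f).1) e))) ℂ
      (K.edgeInvariants (fun f => (ρ f).1) e)

/-- The contribution of a labelling `ρ` of the polygons to the spin foam sum:
`(∏_e ∑_{P^{(e)}}) (∏_f ŵ_{ρ_f}) (∏_v C(v))`. -/
noncomputable def spinFoamTerm [MeasurableSpace G] (μ : Measure G) (w : G → ℝ)
    {I : Set (UnitaryIrrep G)} (P : K.ProjectorBases I) (ρ : F → I) : ℂ :=
  ∑ j : ((e : E) → Fin (Module.finrank ℂ (K.edgeInvariants (fun f => (ρ f).1) e))),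
    (∏ f, (ρ f).1.coeff μ w) *
      ∏ v, K.vertexWeight (fun f => (ρ f).1) (fun e => (P ρ e (j e) : K.EdgeSpace _ e)) v

end TwoComplex

/-- The iterated series `∑_{i₀} ∑_{i₁} ⋯ ∑_{i_{n-1}} A (i₀, …, i_{n-1})` converges to `z`, each of
the `n` successive series being (unconditionally) convergent. -/
def IteratedHasSum {ι : Type*} : (n : ℕ) → ((Fin n → ι) → ℂ) → ℂ → Prop
  | 0, A, z => A Fin.elim0 = z
  | n + 1, A, z => ∃ B : ι → ℂ,
      (∀ i, IteratedHasSum n (fun x => A (Fin.cons i x)) (B i)) ∧ HasSum B z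

/-! Every labelling contributes exactly the integral of `∏ f, ŵ_{ρ_f} χ^{(ρ_f)}(g_f)` over `E → G`
(`spinFoamTerm_eq_integral`). The theorem is therefore the character expansion of each factor
`w(g_f)`, followed by an exchange of sums and integral.

The term of a labelling: a character of a holonomy is the trace of a product of matrices, that is, a
sum with one index per corner (`prod_char_holonomy`). After regrouping the factors by edges, the
integral over `g_e` of the edge matrix is the projector onto the invariant vectors, with entries `∑
x_m conj(x_n)` for any orthonormal basis (`integral_eq_sum_invariants`). The index `m` lives on the
corners at the end point of `e` and `n` on those at its starting point, so regrouping by vertices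
produces the weights `C(v)` (`prod_vertexWeight`).

The expansion: the irreducible characters are a Hilbert basis of the `L²` class functions
(`exists_hilbertBasis_charL2`). Orthonormality is Schur's lemma. For completeness, let `k` be a
nonzero class function. Convolution with it is a nonzero compact operator commuting with left
translations, so it is injective on some nonzero finite-dimensional minimal invariant subspace. If
`k` is orthogonal to the conjugates of all characters, Schur's lemma makes the operator vanish
there, a contradiction (`eq_zero_of_integral_mul_char_eq_zero`).

The exchange, case (a): an edge traversed once makes `g_f` Haar distributed
(`measurePreserving_holonomy`). Composition with the holonomy is then an `L²` isometry, and the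
expansion can be integrated against a bounded function, one polygon at a time
(`iteratedHasSum_integral`). Case (b): the expansion converges absolutely in the sup norm, so the
series are multiplied out in the Banach algebra `C(E → G, ℂ)` and integrated term by term. -/

set_option linter.unusedSectionVars false

/-! ### Invariance of Haar measure on compact groups -/

section HaarInvariance

variable {G : Type*} [Group G] [TopologicalSpace G] [IsTopologicalGroup G] [CompactSpace G]
  [MeasurableSpace G] [BorelSpace G]
  (μ : Measure G) [μ.IsHaarMeasure] [IsProbabilityMeasure μ]

/-- The Haar probability measure of a compact group is right invariant. -/
theorem isMulRightInvariant_of_compactSpace : μ.IsMulRightInvariant where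
  map_mul_right_eq_self g := by
    have : IsProbabilityMeasure (μ.map (· * g)) :=
      Measure.isProbabilityMeasure_map (measurable_mul_const g).aemeasurable
    exact Measure.isHaarMeasure_eq_of_isProbabilityMeasure _ _

/-- The Haar probability measure of a compact group is invariant under inversion. -/
theorem isInvInvariant_of_compactSpace : μ.IsInvInvariant where
  inv_eq_self := by
    have := isMulRightInvariant_of_compactSpace μ
    have : IsProbabilityMeasure μ.inv :=
      Measure.isProbabilityMeasure_map measurable_inv.aemeasurable
    have : μ.inv.IsOpenPosMeasure := continuous_inv.isOpenPosMeasure_map inv_surjective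
    have : μ.inv.IsHaarMeasure := {}
    exact Measure.isHaarMeasure_eq_of_isProbabilityMeasure _ _

end HaarInvariance

/-! ### Entrywise integrals of matrices -/

section MatrixIntegral

variable {X : Type*} [MeasurableSpace X] (μ : Measure X) {m n p : Type*} [Fintype n] [Fintype m]

/-- The entrywise integral of a matrix-valued function. -/
noncomputable def matrixIntegral {m n : Type*} (M : X → Matrix m n ℂ) : Matrix m n ℂ :=
  fun i j => ∫ x, M x i j ∂μ

theorem mul_matrixIntegral (A : Matrix m n ℂ) {M : X → Matrix n p ℂ}
    (hM : ∀ i j, Integrable (fun x => M x i j) μ) :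
    A * matrixIntegral μ M = matrixIntegral μ fun x => A * M x := by
  ext i j
  simp only [matrixIntegral, Matrix.mul_apply, ← integral_const_mul]
  rw [integral_finsetSum]
  exact fun k _ => (hM k j).const_mul _

theorem matrixIntegral_mul (A : Matrix m n ℂ) {M : X → Matrix p m ℂ}
    (hM : ∀ i j, Integrable (fun x => M x i j) μ) :
    matrixIntegral μ M * A = matrixIntegral μ fun x => M x * A := by
  ext i j
  simp only [matrixIntegral, Matrix.mul_apply, ← integral_mul_const]
  rw [integral_finsetSum]
  exact fun k _ => (hM i k).mul_const _

theorem trace_matrixIntegral {M : X → Matrix n n ℂ}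
    (hM : ∀ i j, Integrable (fun x => M x i j) μ) :
    (matrixIntegral μ M).trace = ∫ x, (M x).trace ∂μ := by
  simp only [matrixIntegral, Matrix.trace, Matrix.diag]
  rw [integral_finsetSum]
  exact fun k _ => hM k k

end MatrixIntegral

/-! ### Schur's lemma and orthogonality of characters -/

namespace UnitaryIrrep

variable {G : Type*} [Group G] [TopologicalSpace G]

open Matrix

section Basic

variable (ρ σ : UnitaryIrrep G)

theorem t_mul (g h : G) : ρ.t (g * h) = ρ.t g * ρ.t h := by simp [t]

theorem t_one : ρ.t 1 = 1 := by simp [t]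

theorem t_inv (g : G) : ρ.t g⁻¹ = (ρ.t g)ᴴ := by
  simp only [t, map_inv]; rfl

theorem continuous_t : Continuous ρ.t := continuous_subtype_val.comp ρ.continuous_mat

theorem continuous_t_apply (i j : Fin ρ.dim) : Continuous fun g => ρ.t g i j :=
  ρ.continuous_t.matrix_elem i j

theorem continuous_char : Continuous ρ.char := ρ.continuous_t.matrix_trace

theorem norm_t_apply_le (g : G) (i j : Fin ρ.dim) : ‖ρ.t g i j‖ ≤ 1 :=
  _root_.entry_norm_bound_of_unitary (𝕜 := ℂ) (ρ.mat g).2 i j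

theorem norm_char_le (g : G) : ‖ρ.char g‖ ≤ ρ.dim := by
  refine (norm_sum_le Finset.univ fun i => ρ.t g i i).trans ?_
  refine (Finset.sum_le_sum fun i _ => ρ.norm_t_apply_le g i i).trans ?_
  simp

/-- Irreducibility excludes the zero space. This allows division by the dimension and the choice of
a basis vector. -/
theorem dim_pos : 0 < ρ.dim := by
  rcases Nat.eq_zero_or_pos ρ.dim with h | h
  · exfalso
    have := ρ.irreducible
    have : Subsingleton (Fin ρ.dim → ℂ) := by
      rw [h]; infer_instance
    have hbt : (⊥ : Subrepresentation (unitaryMatrixRep ρ.mat)) = ⊤ := by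
      apply Subrepresentation.toSubmodule_injective
      exact Subsingleton.elim _ _
    exact bot_ne_top hbt
  · exact h

variable {ρ σ}

/-- The intertwining map defined by a matrix. -/
noncomputable def intertwiningMapOfMatrix (A : Matrix (Fin ρ.dim) (Fin σ.dim) ℂ)
    (hA : ∀ g, ρ.t g * A = A * σ.t g) :
    Representation.IntertwiningMap (unitaryMatrixRep σ.mat) (unitaryMatrixRep ρ.mat) where
  toLinearMap := Matrix.toLin' A
  isIntertwining' g := by
    refine LinearMap.ext fun v => ?_
    change A *ᵥ (σ.t g *ᵥ v) = ρ.t g *ᵥ (A *ᵥ v)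
    rw [Matrix.mulVec_mulVec, Matrix.mulVec_mulVec, hA]

/-- Schur's lemma, first half, in matrix form. -/
theorem eq_zero_of_intertwines (h : ¬ σ.Equivalent ρ) (A : Matrix (Fin ρ.dim) (Fin σ.dim) ℂ)
    (hA : ∀ g, ρ.t g * A = A * σ.t g) : A = 0 := by
  have := ρ.irreducible
  have := σ.irreducible
  have : IsEmpty (Representation.Equiv (unitaryMatrixRep σ.mat) (unitaryMatrixRep ρ.mat)) :=
    not_nonempty_iff.1 h
  have h0 : intertwiningMapOfMatrix A hA = 0 := Subsingleton.elim _ _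
  have h1 : Matrix.toLin' A = 0 := congrArg (fun f => f.toLinearMap) h0
  simpa using h1

/-- Schur's lemma, second half: over an algebraically closed field the self-intertwiners are
scalars. -/
theorem exists_eq_smul_one_of_commutes (A : Matrix (Fin ρ.dim) (Fin ρ.dim) ℂ)
    (hA : ∀ g, ρ.t g * A = A * ρ.t g) : ∃ c : ℂ, A = c • 1 := by
  have := ρ.irreducible
  obtain ⟨c, hc⟩ := (Representation.IsIrreducible.algebraMap_intertwiningMap_bijective_of_isAlgClosed
    (ρ := unitaryMatrixRep ρ.mat)).2 (intertwiningMapOfMatrix A hA)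
  refine ⟨c, ?_⟩
  have h1 : Matrix.toLin' A = c • LinearMap.id :=
    (congrArg (fun f => f.toLinearMap) hc).symm
  have := congrArg LinearMap.toMatrix' h1
  simpa using this

theorem char_eq_of_equivalent (h : σ.Equivalent ρ) : σ.char = ρ.char := by
  obtain ⟨e⟩ := h
  funext g
  have h1 : ∀ τ : UnitaryIrrep G, τ.char g = LinearMap.trace ℂ _ (unitaryMatrixRep τ.mat g) :=
    fun τ => (Matrix.trace_toLin'_eq (τ.t g)).symm
  rw [h1, h1, ← LinearMap.trace_conj' _ e.toLinearEquiv]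
  congr 1
  refine LinearMap.ext fun v => ?_
  have h2 := Representation.IntertwiningMap.isIntertwining _ _ e.toIntertwiningMap g (e.toLinearEquiv.symm v)
  change e.toLinearEquiv _ = _ at h2
  rw [LinearEquiv.conj_apply_apply, h2]
  exact congrArg _ (e.toLinearEquiv.apply_symm_apply v)

theorem char_conj (g h : G) : ρ.char (h * g * h⁻¹) = ρ.char g := by
  rw [char, t_mul, t_mul, Matrix.trace_mul_comm, ← mul_assoc, ← t_mul, inv_mul_cancel, t_one,
    one_mul, char]

end Basic

section Orthogonality

variable [IsTopologicalGroup G] [CompactSpace G] [MeasurableSpace G] [BorelSpace G]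
  (μ : Measure G) [μ.IsHaarMeasure] [IsProbabilityMeasure μ] {ρ σ : UnitaryIrrep G}

theorem integrable_of_continuous {f : G → ℂ} (hf : Continuous f) : Integrable f μ :=
  hf.integrable_of_hasCompactSupport (HasCompactSupport.of_compactSpace f)

/-- Substituting `h * g` for `g` on the right-hand side turns it into the left-hand side. Averaging
thus feeds arbitrary matrices into Schur's lemma. -/
theorem average_intertwines (A : Matrix (Fin ρ.dim) (Fin σ.dim) ℂ) (h : G) :
    ρ.t h * matrixIntegral μ (fun g => ρ.t g * A * σ.t g⁻¹) =
      matrixIntegral μ (fun g => ρ.t g * A * σ.t g⁻¹) * σ.t h := by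
  have hi : ∀ i j, Integrable (fun g => (ρ.t g * A * σ.t g⁻¹) i j) μ := fun i j =>
    integrable_of_continuous μ ((((ρ.continuous_t.matrix_mul continuous_const).matrix_mul
      (σ.continuous_t.comp continuous_inv))).matrix_elem i j)
  rw [mul_matrixIntegral μ _ hi, matrixIntegral_mul μ _ hi]
  ext i j
  simp only [matrixIntegral]
  rw [← integral_mul_left_eq_self (fun g => (ρ.t g * A * σ.t g⁻¹ * σ.t h) i j) h (μ := μ)]
  refine integral_congr_ae (.of_forall fun g => congrFun (congrFun ?_ i) j)
  simp only [t_mul, _root_.mul_inv_rev, Matrix.mul_assoc]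
  rw [← t_mul σ h⁻¹ h, inv_mul_cancel, t_one, Matrix.mul_one]

/-- Unitarity gives `star (σ.t g k l) = σ.t g⁻¹ l k`, so the integral is an entry of the average of
a matrix unit. -/
theorem integral_t_mul_star_t (i : Fin ρ.dim) (k : Fin σ.dim) (j : Fin ρ.dim) (l : Fin σ.dim) :
    ∫ g, ρ.t g i j * star (σ.t g k l) ∂μ =
      matrixIntegral μ (fun g => ρ.t g * Matrix.single j l (1 : ℂ) * σ.t g⁻¹) i k := by
  refine integral_congr_ae (.of_forall fun g => ?_)
  dsimp only
  rw [Matrix.mul_apply, Finset.sum_eq_single l]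
  · simp [t_inv]
  · intro b _ hb
    rw [Matrix.mul_single_apply_of_ne _ _ _ _ _ hb, zero_mul]
  · simp

theorem integral_char_mul_star_char :
    ∫ g, ρ.char g * star (σ.char g) ∂μ =
      ∑ i, ∑ k, ∫ g, ρ.t g i i * star (σ.t g k k) ∂μ := by
  simp only [char, Matrix.trace, Matrix.diag, star_sum, Finset.sum_mul_sum]
  rw [integral_finsetSum]
  · refine Finset.sum_congr rfl fun i _ => ?_
    rw [integral_finsetSum]
    exact fun k _ => integrable_of_continuous μ
      ((ρ.continuous_t_apply i i).mul (σ.continuous_t_apply k k).star)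
  · exact fun i _ => integrable_of_continuous μ (continuous_finsetSum _ fun k _ =>
      ((ρ.continuous_t_apply i i).mul (σ.continuous_t_apply k k).star))

theorem integral_char_mul_star_char_of_not_equivalent (h : ¬ σ.Equivalent ρ) :
    ∫ g, ρ.char g * star (σ.char g) ∂μ = 0 := by
  rw [integral_char_mul_star_char]
  refine Finset.sum_eq_zero fun i _ => Finset.sum_eq_zero fun k _ => ?_
  rw [integral_t_mul_star_t,
    eq_zero_of_intertwines h _ (average_intertwines μ (Matrix.single i k (1 : ℂ)))]
  rfl

theorem integral_char_mul_star_char_self : ∫ g, ρ.char g * star (ρ.char g) ∂μ = 1 := by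
  have hd : (ρ.dim : ℂ) ≠ 0 := Nat.cast_ne_zero.2 ρ.dim_pos.ne'
  -- The average of the matrix unit at `(i, k)` is a scalar matrix `c • 1`. Averaging preserves the
  -- trace, which is `1` if `i = k` and `0` otherwise, and this fixes `c`.
  have key : ∀ i k, ∫ g, ρ.t g i i * star (ρ.t g k k) ∂μ =
      if i = k then (ρ.dim : ℂ)⁻¹ else 0 := by
    intro i k
    rw [integral_t_mul_star_t]
    have hi : ∀ a b, Integrable (fun g => (ρ.t g * Matrix.single i k (1 : ℂ) * ρ.t g⁻¹) a b) μ :=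
      fun a b => integrable_of_continuous μ ((((ρ.continuous_t.matrix_mul
        continuous_const).matrix_mul (ρ.continuous_t.comp continuous_inv))).matrix_elem a b)
    obtain ⟨c, hc⟩ := exists_eq_smul_one_of_commutes _
      (average_intertwines (ρ := ρ) (σ := ρ) μ (Matrix.single i k (1 : ℂ)))
    have htr := trace_matrixIntegral μ hi
    have h2 : ∀ g, (ρ.t g * Matrix.single i k (1 : ℂ) * ρ.t g⁻¹).trace = if i = k then 1 else 0 := by
      intro g
      rw [Matrix.trace_mul_comm, ← mul_assoc, ← t_mul, inv_mul_cancel, t_one, one_mul]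
      split_ifs with h
      · subst h; simp
      · exact Matrix.trace_single_eq_of_ne _ _ _ h
    simp only [hc, h2, integral_const, probReal_univ, one_smul, Matrix.trace_smul,
      Matrix.trace_one, Fintype.card_fin, smul_eq_mul] at htr
    rw [hc]
    by_cases h : i = k
    · subst h
      simp only [if_true] at htr ⊢
      simpa using eq_inv_of_mul_eq_one_left htr
    · simp [h]
  rw [integral_char_mul_star_char]
  simp only [key]
  simp [hd]

/-- For a square integrable class function `h`, the operator `∫ h(g) ρ(g) dg` is a scalar, hence
zero if `h` is orthogonal to the complex conjugate of the character of `ρ`. -/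
theorem matrixIntegral_smul_t_eq_zero {h : G → ℂ} (hL : Integrable h μ)
    (hcl : ∀ x : G, (fun g => h (x * g * x⁻¹)) =ᵐ[μ] h)
    (h0 : ∫ g, h g * ρ.char g ∂μ = 0) :
    matrixIntegral μ (fun g => h g • ρ.t g) = 0 := by
  have hri := isMulRightInvariant_of_compactSpace μ
  have hi : ∀ a b, Integrable (fun g => (h g • ρ.t g) a b) μ := fun a b =>
    hL.mul_bdd (c := 1) (ρ.continuous_t_apply a b).aestronglyMeasurable
      (.of_forall fun g => ρ.norm_t_apply_le g a b)
  obtain ⟨c, hc⟩ := exists_eq_smul_one_of_commutes (ρ := ρ)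
      (matrixIntegral μ (fun g => h g • ρ.t g)) fun x => by
    rw [mul_matrixIntegral μ _ hi, matrixIntegral_mul μ _ hi]
    ext a b
    simp only [matrixIntegral]
    have hmp : MeasurePreserving (fun g => x * g * x⁻¹) μ μ :=
      (measurePreserving_mul_right μ x⁻¹).comp (measurePreserving_mul_left μ x)
    -- Conjugating the variable leaves `h` unchanged almost everywhere and turns `t(x g x⁻¹) t(x)`
    -- into `t(x) t(g)`, so the integral commutes with `ρ` and is a scalar `c`. Its trace `c * dim`
    -- is the integral assumed to vanish.
    have e : ∫ g, (h g • ρ.t g * ρ.t x) a b ∂μ =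
        ∫ g, (h (x * g * x⁻¹) • ρ.t (x * g * x⁻¹) * ρ.t x) a b ∂μ := by
      rw [← integral_mul_left_eq_self _ x (μ := μ), ← integral_mul_right_eq_self _ x⁻¹ (μ := μ)]
      simp only [mul_assoc]
    rw [e]
    refine integral_congr_ae ?_
    filter_upwards [hcl x] with g hg
    rw [hg, Matrix.mul_smul, Matrix.smul_mul, ← t_mul, ← t_mul]
    simp
  have htr := trace_matrixIntegral μ hi
  simp only [Matrix.trace_smul, smul_eq_mul] at htr
  change _ = ∫ g, h g * ρ.char g ∂μ at htr
  rw [h0, hc, Matrix.trace_smul, Matrix.trace_one, Fintype.card_fin, smul_eq_mul] at htr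
  have hd : (ρ.dim : ℂ) ≠ 0 := Nat.cast_ne_zero.2 ρ.dim_pos.ne'
  rw [hc, (mul_eq_zero.1 htr).resolve_right hd, zero_smul]

end Orthogonality

end UnitaryIrrep

/-! ### Compact operators commuting with a unitary representation -/

section CompactOperator

variable {X H : Type*} [TopologicalSpace X] [CompactSpace X] [NormedAddCommGroup H]
  [InnerProductSpace ℂ H]

/-- The operator sending `f` to the continuous function `x ↦ ⟪κ x, f⟫`. -/
noncomputable def innerFamily (κ : C(X, H)) : H →L[ℂ] C(X, ℂ) :=
  LinearMap.mkContinuous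
    { toFun := fun f => ⟨fun x => inner ℂ (κ x) f, by fun_prop⟩
      map_add' := fun f g => by ext x; simp
      map_smul' := fun c f => by ext x; simp } ‖κ‖ fun f => by
    refine (ContinuousMap.norm_le _ (by positivity)).2 fun x => ?_
    exact (norm_inner_le_norm _ _).trans
      (mul_le_mul_of_nonneg_right (κ.norm_coe_le_norm x) (norm_nonneg f))

/-- Arzelà–Ascoli: by Cauchy–Schwarz the image of the unit ball is bounded by `‖κ‖`, and it is
equicontinuous because `κ` is norm continuous. -/
theorem isCompactOperator_innerFamily (κ : C(X, H)) : IsCompactOperator (innerFamily κ) := by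
  have key : IsCompactOperator (fun f => BoundedContinuousFunction.mkOfCompact (innerFamily κ f)) := by
    let L : C(X, ℂ) →L[ℂ] (BoundedContinuousFunction X ℂ) :=
      (ContinuousMap.linearIsometryBoundedOfCompact X ℂ ℂ).toContinuousLinearEquiv
    change IsCompactOperator (L ∘L innerFamily κ)
    refine (isCompactOperator_iff_isCompact_closure_image_ball (L ∘L innerFamily κ).toLinearMap
      (r := 1) one_pos).2 ?_
    refine BoundedContinuousFunction.arzela_ascoli (Metric.closedBall 0 ‖κ‖)
      (isCompact_closedBall _ _) _ ?_ ?_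
    · rintro _ x ⟨f, hf, rfl⟩
      rw [mem_ball_zero_iff] at hf
      rw [mem_closedBall_zero_iff]
      refine (norm_inner_le_norm (κ x) f).trans ?_
      have := κ.norm_coe_le_norm x
      nlinarith [norm_nonneg f, norm_nonneg (κ x)]
    · intro x₀
      rw [Metric.equicontinuousAt_iff_right]
      intro ε hε
      have := Metric.tendsto_nhds.1 (κ.continuous.tendsto x₀) ε hε
      filter_upwards [this] with x hx
      rintro ⟨_, f, hf, rfl⟩
      rw [mem_ball_zero_iff] at hf
      change dist (inner ℂ (κ x₀) f) (inner ℂ (κ x) f) < ε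
      rw [dist_comm, dist_eq_norm, ← inner_sub_left]
      refine (norm_inner_le_norm _ _).trans_lt ?_
      rw [dist_eq_norm] at hx
      nlinarith [norm_nonneg f, norm_nonneg (κ x - κ x₀)]
  exact key.clm_comp
    ((ContinuousMap.linearIsometryBoundedOfCompact X ℂ ℂ).symm.toContinuousLinearEquiv :
      (BoundedContinuousFunction X ℂ) →L[ℂ] C(X, ℂ))

/-- A nonzero compact operator commuting with a unitary representation of a group has a
nonzero finite-dimensional invariant subspace on which it is injective. -/
theorem exists_minimal_invariant_submodule {G : Type*} [Group G] [CompleteSpace H]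
    (U : Representation ℂ G H) (hU : ∀ g x y, inner ℂ (U g x) (U g y) = inner ℂ x y)
    (T : H →L[ℂ] H) (hT : IsCompactOperator T) (hT0 : T ≠ 0) (hTU : ∀ g f, T (U g f) = U g (T f)) :
    ∃ p : Submodule ℂ H, FiniteDimensional ℂ p ∧ p ≠ ⊥ ∧ (∀ g, ∀ f ∈ p, U g f ∈ p) ∧
      (∀ q ≤ p, (∀ g, ∀ f ∈ q, U g f ∈ q) → q = ⊥ ∨ q = p) ∧ ∀ f ∈ p, T f = 0 → f = 0 := by
  classical
  -- Passing to `T* T` gives a self-adjoint operator, still compact, nonzero and commuting with `U`.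
  -- The spectral theorem supplies a nonzero eigenvalue with finite-dimensional eigenspace.
  set A : H →L[ℂ] H := T.adjoint ∘L T with hA
  have hAc : IsCompactOperator A := hT.clm_comp T.adjoint
  have hAs : (A : H →ₗ[ℂ] H).IsSymmetric := by
    intro x y
    simp [hA, ContinuousLinearMap.adjoint_inner_left, ContinuousLinearMap.adjoint_inner_right]
  have hA0 : A ≠ 0 := by
    intro h
    apply hT0
    ext1 x
    have : inner ℂ (A x) x = (0 : ℂ) := by rw [h]; simp
    rw [hA, ContinuousLinearMap.comp_apply, ContinuousLinearMap.adjoint_inner_left,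
      inner_self_eq_zero] at this
    simpa using this
  have hAU : ∀ g f, A (U g f) = U g (A f) := by
    intro g f
    refine ext_inner_right ℂ fun y => ?_
    have hinv : ∀ x y, inner ℂ (U g x) y = inner ℂ x (U g⁻¹ y) := by
      intro x y
      rw [← hU g x, ← Module.End.mul_apply, ← map_mul]
      simp
    rw [hA, ContinuousLinearMap.comp_apply, ContinuousLinearMap.adjoint_inner_left, hTU, hinv,
      hinv, ← hTU, ContinuousLinearMap.comp_apply, ContinuousLinearMap.adjoint_inner_left]
  obtain ⟨c, hc, hc0⟩ : ∃ c : ℂ, Module.End.HasEigenvalue (A : H →ₗ[ℂ] H) c ∧ c ≠ 0 := by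
    by_contra! hcon
    exact hA0 ((ContinuousLinearMap.eq_zero_of_forall_hasEigenvalue_eq_zero hAc hAs).1 hcon)
  have hfin := ContinuousLinearMap.finite_dimensional_eigenspace hAc c hc0
  set W := Module.End.eigenspace (A : H →ₗ[ℂ] H) c with hW
  have hWmem : ∀ f, f ∈ W ↔ A f = c • f := fun f => Module.End.mem_eigenspace_iff
  -- A nonzero invariant subspace of least dimension inside the eigenspace is minimal, and `T f = 0`
  -- there forces `c • f = 0`.
  let Q : ℕ → Prop := fun n => ∃ p ≤ W, p ≠ ⊥ ∧ (∀ g, ∀ f ∈ p, U g f ∈ p) ∧ Module.finrank ℂ p = n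
  have hQ : ∃ n, Q n := by
    refine ⟨_, W, le_rfl, hc, fun g f hf => ?_, rfl⟩
    rw [hWmem] at hf ⊢
    rw [hAU, hf, map_smul]
  obtain ⟨p, hpW, hp0, hpU, hpn⟩ := Nat.find_spec hQ
  have hpf : FiniteDimensional ℂ p := Submodule.finiteDimensional_of_le hpW
  refine ⟨p, hpf, hp0, hpU, fun q hqp hqU => ?_, fun f hf hTf => ?_⟩
  · by_cases hq : q = ⊥
    · exact Or.inl hq
    · right
      refine Submodule.eq_of_le_of_finrank_le hqp ?_
      rw [hpn]
      exact Nat.find_min' hQ ⟨q, hqp.trans hpW, hq, hqU, rfl⟩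
  · have h1 := (hWmem f).1 (hpW hf)
    rw [hA, ContinuousLinearMap.comp_apply, hTf, map_zero] at h1
    exact (smul_eq_zero.1 h1.symm).resolve_left hc0

end CompactOperator

/-- A continuous unitary irreducible representation on a finite-dimensional Hilbert space,
written in an orthonormal basis. -/
theorem UnitaryIrrep.exists_of_representation {G E : Type*} [Group G] [TopologicalSpace G]
    [NormedAddCommGroup E] [InnerProductSpace ℂ E] [FiniteDimensional ℂ E] [Nontrivial E]
    (π : Representation ℂ G E) (hπ : ∀ g x y, inner ℂ (π g x) (π g y) = inner ℂ x y)
    (hcont : ∀ x, Continuous fun g => π g x)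
    (hirr : ∀ q : Submodule ℂ E, (∀ g, ∀ x ∈ q, π g x ∈ q) → q = ⊥ ∨ q = ⊤) :
    ∃ (σ : UnitaryIrrep G) (b : OrthonormalBasis (Fin σ.dim) ℂ E),
      ∀ g i j, σ.t g i j = inner ℂ (b i) (π g (b j)) := by
  set b := stdOrthonormalBasis ℂ E
  set n := Module.finrank ℂ E
  let M : G →* Matrix (Fin n) (Fin n) ℂ :=
    ((LinearMap.toMatrixAlgEquiv b.toBasis : (E →ₗ[ℂ] E) ≃ₐ[ℂ] _) :
      (E →ₗ[ℂ] E) →* Matrix (Fin n) (Fin n) ℂ).comp π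
  have hM : ∀ g i j, M g i j = inner ℂ (b i) (π g (b j)) := by
    intro g i j
    change LinearMap.toMatrixAlgEquiv b.toBasis (π g) i j = _
    rw [LinearMap.toMatrixAlgEquiv_apply]
    simp [OrthonormalBasis.repr_apply_apply]
  have hstar : ∀ g, star (M g) = M g⁻¹ := by
    intro g
    ext i j
    rw [Matrix.star_apply, hM, hM, ← hπ g (b i), ← Module.End.mul_apply, ← map_mul]
    simp
  have hu : ∀ g, M g ∈ Matrix.unitaryGroup (Fin n) ℂ := by
    intro g
    rw [Matrix.mem_unitaryGroup_iff, hstar, ← map_mul, mul_inv_cancel, map_one]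
  let m : G →* Matrix.unitaryGroup (Fin n) ℂ := M.codRestrict _ hu
  -- The coordinate map intertwines the two actions, so subrepresentations of the matrix
  -- representation pull back to invariant subspaces of `E`.
  have hact : ∀ g v, unitaryMatrixRep m g (b.toBasis.equivFun v) = b.toBasis.equivFun (π g v) := by
    intro g v
    exact LinearMap.toMatrix_mulVec_repr b.toBasis b.toBasis (π g) v
  refine ⟨⟨n, m, ?_, ?_⟩, b, hM⟩
  · refine Continuous.subtype_mk ?_ _
    refine continuous_matrix fun i j => ?_
    simp only [hM]
    exact continuous_const.inner (hcont _)
  · have hnt : Nontrivial (Subrepresentation (unitaryMatrixRep m)) := by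
      refine ⟨⊥, ⊤, fun h => ?_⟩
      have h1 : (⊥ : Submodule ℂ (Fin n → ℂ)) = ⊤ := congrArg Subrepresentation.toSubmodule h
      have : Nontrivial (Fin n → ℂ) := b.toBasis.equivFun.toEquiv.symm.nontrivial
      exact bot_ne_top h1
    refine { eq_bot_or_eq_top := fun τ => ?_ }
    have hinj : Function.Injective fun p : Submodule ℂ (Fin n → ℂ) =>
        p.comap (b.toBasis.equivFun : E →ₗ[ℂ] (Fin n → ℂ)) :=
      Submodule.comap_injective_of_surjective b.toBasis.equivFun.surjective
    rcases hirr (τ.toSubmodule.comap (b.toBasis.equivFun : E →ₗ[ℂ] (Fin n → ℂ))) (fun g x hx => by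
      have := τ.apply_mem_toSubmodule g hx
      rw [Submodule.mem_comap]
      exact (hact g x) ▸ this) with h | h
    · left
      apply Subrepresentation.toSubmodule_injective
      apply hinj
      dsimp only
      rw [h]
      change ⊥ = Submodule.comap _ ⊥
      ext x
      simp
    · right
      apply Subrepresentation.toSubmodule_injective
      apply hinj
      dsimp only
      rw [h]
      rfl

theorem L2_inner_eq {X : Type*} [MeasurableSpace X] {μ : Measure X} (f g : Lp ℂ 2 μ) :
    inner ℂ f g = ∫ x, star (f x) * g x ∂μ := by
  rw [L2.inner_def]
  refine integral_congr_ae (.of_forall fun x => ?_)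
  simp [mul_comm]

/-! ### Completeness of the characters among class functions -/

section PeterWeyl

variable {G : Type*} [Group G] [TopologicalSpace G] [IsTopologicalGroup G] [CompactSpace G]
  [T2Space G] [SecondCountableTopology G] [MeasurableSpace G] [BorelSpace G]
  (μ : Measure G) [μ.IsHaarMeasure] [IsProbabilityMeasure μ]

/-- The left regular representation on `L²(G)`. -/
noncomputable def leftRegular : Representation ℂ G (Lp ℂ 2 μ) where
  toFun g := (Lp.compMeasurePreservingₗᵢ ℂ (fun x => g⁻¹ * x)
    (measurePreserving_mul_left μ g⁻¹)).toLinearMap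
  map_one' := by
    ext1 f
    change Lp.compMeasurePreserving _ _ f = f
    simp only [inv_one, one_mul]
    exact Lp.compMeasurePreserving_id_apply f
  map_mul' g h := by
    ext1 f
    change Lp.compMeasurePreserving _ _ f =
      Lp.compMeasurePreserving _ _ (Lp.compMeasurePreserving _ _ f)
    rw [← Lp.compMeasurePreserving_comp_apply]
    have h : (fun x => (g * h)⁻¹ * x) = (fun x => h⁻¹ * x) ∘ fun x => g⁻¹ * x := by
      funext x
      simp [mul_assoc]
    simp only [h]

theorem leftRegular_coeFn (g : G) (f : Lp ℂ 2 μ) :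
    leftRegular μ g f =ᵐ[μ] fun x => f (g⁻¹ * x) :=
  Lp.coeFn_compMeasurePreserving f (measurePreserving_mul_left μ g⁻¹)

theorem leftRegular_inner (g : G) (x y : Lp ℂ 2 μ) :
    inner ℂ (leftRegular μ g x) (leftRegular μ g y) = inner ℂ x y :=
  (Lp.compMeasurePreservingₗᵢ ℂ (fun x => g⁻¹ * x)
    (measurePreserving_mul_left μ g⁻¹)).inner_map_map x y

theorem continuous_leftRegular (f : Lp ℂ 2 μ) : Continuous fun g => leftRegular μ g f := by
  have h : Continuous fun g : G => (⟨fun x => g⁻¹ * x, by fun_prop⟩ : C(G, G)) :=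
    ContinuousMap.continuous_of_continuous_uncurry _ (by
      change Continuous fun p : G × G => p.1⁻¹ * p.2
      fun_prop)
  exact Continuous.compMeasurePreservingLp (p := 2) (continuous_const (y := f)) h
    (fun g => measurePreserving_mul_left μ g⁻¹) (by simp)

theorem memLp_two_mul_prod {f g : G → ℂ} (hf : MemLp f 2 μ) (hg : MemLp g 2 μ) :
    MemLp (fun p : G × G => f p.1 * g p.2) 2 (μ.prod μ) := by
  refine (memLp_two_iff_integrable_sq_norm (hf.1.comp_fst.mul hg.1.comp_snd)).2 ?_
  refine Integrable.congr (f := fun p : G × G => ‖f p.1‖ ^ 2 * ‖g p.2‖ ^ 2) ?_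
    (.of_forall fun p => by simp [mul_pow])
  exact ((memLp_two_iff_integrable_sq_norm hf.1).1 hf).mul_prod
    ((memLp_two_iff_integrable_sq_norm hg.1).1 hg)

/-- Fubini's theorem for the convolution with a class function. -/
theorem integral_star_mul_inner_leftRegular (k φ f : Lp ℂ 2 μ)
    (hk : ∀ x : G, (fun g => k (x * g * x⁻¹)) =ᵐ[μ] k) :
    ∫ z, star (φ z) * inner ℂ (leftRegular μ z k) f ∂μ =
      ∫ y, star (k y) * inner ℂ φ (leftRegular μ y⁻¹ f) ∂μ := by
  have hri := isMulRightInvariant_of_compactSpace μ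
  have h1 : ∀ z, inner ℂ (leftRegular μ z k) f = ∫ y, star (k y) * f (y * z) ∂μ := by
    intro z
    rw [L2_inner_eq]
    have e1 : ∫ x, star (leftRegular μ z k x) * f x ∂μ = ∫ x, star (k (z⁻¹ * x)) * f x ∂μ := by
      refine integral_congr_ae ?_
      filter_upwards [leftRegular_coeFn μ z k] with x hx
      rw [hx]
    rw [e1, ← integral_mul_right_eq_self _ z (μ := μ)]
    refine integral_congr_ae ?_
    -- After the right translation the argument of `k` is `z⁻¹ x z`, and the class property removes
    -- `z`.
    filter_upwards [hk z⁻¹] with x hx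
    rw [inv_inv] at hx
    rw [← mul_assoc, hx]
  have h2 : ∀ y, inner ℂ φ (leftRegular μ y⁻¹ f) = ∫ z, star (φ z) * f (y * z) ∂μ := by
    intro y
    rw [L2_inner_eq]
    refine integral_congr_ae ?_
    filter_upwards [leftRegular_coeFn μ y⁻¹ f] with x hx
    rw [hx, inv_inv]
  simp only [h1, h2, ← integral_const_mul]
  rw [integral_integral_swap]
  · refine integral_congr_ae (.of_forall fun y => integral_congr_ae (.of_forall fun z => ?_))
    ring
  -- Fubini applies because the integrand is a product of two `L²` functions on `G × G`: a tensor
  -- product, and `f` composed with a measure preserving map.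
  · have hmp : MeasurePreserving (fun p : G × G => p.2 * p.1) (μ.prod μ) μ :=
      measurePreserving_snd.comp (measurePreserving_prod_mul_swap μ μ)
    have := (memLp_two_mul_prod μ (Lp.memLp φ).star (Lp.memLp k).star).integrable_mul
      ((Lp.memLp f).comp_measurePreserving hmp)
    refine this.congr (.of_forall fun p => ?_)
    simp [Function.uncurry, mul_assoc]

/-- A square integrable class function is zero if it is orthogonal to the complex conjugates of
all irreducible characters. -/
theorem eq_zero_of_integral_mul_char_eq_zero (k : Lp ℂ 2 μ)
    (hk : ∀ x : G, (fun g => k (x * g * x⁻¹)) =ᵐ[μ] k)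
    (h0 : ∀ σ : UnitaryIrrep G, ∫ g, k g * σ.char g ∂μ = 0) : k = 0 := by
  by_contra hk0
  let κ : C(G, Lp ℂ 2 μ) := ⟨fun g => leftRegular μ g k, continuous_leftRegular μ k⟩
  -- Convolution with `k`, factored through the continuous functions. This gives compactness, and
  -- also makes the value of `T k` at `1` meaningful: it is `‖k‖²`, whence `T ≠ 0`.
  let T : Lp ℂ 2 μ →L[ℂ] Lp ℂ 2 μ := ContinuousMap.toLp 2 μ ℂ ∘L innerFamily κ
  have hT : IsCompactOperator T := 
    (isCompactOperator_innerFamily κ).clm_comp (ContinuousMap.toLp 2 μ ℂ)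
  have hTc : ∀ f, T f =ᵐ[μ] fun z => inner ℂ (leftRegular μ z k) f := fun f =>
    ContinuousMap.coeFn_toLp μ (innerFamily κ f)
  have hT0 : T ≠ 0 := by
    intro h
    have h1 : innerFamily κ k = 0 := by
      apply ContinuousMap.toLp_injective (p := 2) (𝕜 := ℂ) μ
      rw [map_zero]
      exact congrArg (fun S : Lp ℂ 2 μ →L[ℂ] Lp ℂ 2 μ => S k) h
    have h2 : inner ℂ (leftRegular μ 1 k) k = (0 : ℂ) := DFunLike.congr_fun h1 1
    rw [map_one, Module.End.one_apply, inner_self_eq_zero] at h2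
    exact hk0 h2
  have hTU : ∀ g f, T (leftRegular μ g f) = leftRegular μ g (T f) := by
    intro g f
    apply Lp.ext
    have h3 := (measurePreserving_mul_left μ g⁻¹).quasiMeasurePreserving.ae (hTc f)
    filter_upwards [hTc (leftRegular μ g f), leftRegular_coeFn μ g (T f), h3] with z h1 h2 h3
    rw [h1, h2, h3, ← leftRegular_inner μ g _ f, ← Module.End.mul_apply, ← map_mul,
      mul_inv_cancel_left]
  obtain ⟨p, hpf, hp0, hpU, hpmin, hpT⟩ := exists_minimal_invariant_submodule (leftRegular μ)
    (leftRegular_inner μ) T hT hT0 hTU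
  have : Nontrivial p := Submodule.nontrivial_iff_ne_bot.2 hp0
  let π : Representation ℂ G p := Subrepresentation.toRepresentation
    (ρ := leftRegular μ) ⟨p, fun g v hv => hpU g v hv⟩
  have hπ : ∀ g (x : p), (π g x : Lp ℂ 2 μ) = leftRegular μ g x := fun g x => rfl
  obtain ⟨σ, b, hσ⟩ := UnitaryIrrep.exists_of_representation π
    (fun g x y => leftRegular_inner μ g x y)
    (fun x => Continuous.subtype_mk (continuous_leftRegular μ x) _) (fun q hq => by
      rcases hpmin (q.map p.subtype) (Submodule.map_subtype_le p q) (by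
        rintro g _ ⟨x, hx, rfl⟩
        exact ⟨π g x, hq g x hx, rfl⟩) with h | h
      · left
        apply Submodule.map_injective_of_injective p.subtype_injective
        rw [h, Submodule.map_bot]
      · right
        apply Submodule.map_injective_of_injective p.subtype_injective
        rw [h, Submodule.map_top, Submodule.range_subtype])
  have hkL : MemLp k 2 μ := Lp.memLp k
  have hz := UnitaryIrrep.matrixIntegral_smul_t_eq_zero μ (ρ := σ)
    (hkL.integrable (by norm_num)) hk (h0 σ)
  have hTb : ∀ j, T (b j : Lp ℂ 2 μ) = 0 := by
    intro j
    refine ext_inner_left ℂ fun φ => ?_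
    have e1 : inner ℂ φ (T (b j)) = ∫ z, star (φ z) * inner ℂ (leftRegular μ z k) (b j) ∂μ := by
      rw [L2_inner_eq]
      refine integral_congr_ae ?_
      filter_upwards [hTc (b j)] with z hz
      rw [hz]
    rw [e1, integral_star_mul_inner_leftRegular μ k φ _ hk, inner_zero_right]
    -- On the minimal subspace the translation by `y⁻¹` has the conjugate transpose of `σ.t y` as
    -- its matrix. Hence `T (b j)` pairs with `φ` through conjugates of the entries of `∫ k σ`,
    -- which vanish by `hz`.
    have e2 : ∀ y, star (k y) * inner ℂ φ (leftRegular μ y⁻¹ (b j)) =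
        ∑ i, inner ℂ φ (b i : Lp ℂ 2 μ) * star (k y * σ.t y j i) := by
      intro y
      have : leftRegular μ y⁻¹ (b j) = ∑ i, (star (σ.t y j i)) • (b i : Lp ℂ 2 μ) := by
        rw [← hπ, ← b.sum_repr (π y⁻¹ (b j))]
        simp only [Submodule.coe_sum, Submodule.coe_smul, b.repr_apply_apply, ← hσ]
        simp [UnitaryIrrep.t_inv]
      rw [this, inner_sum, Finset.mul_sum]
      refine Finset.sum_congr rfl fun i _ => ?_
      rw [inner_smul_right, star_mul']
      ring
    simp only [e2]
    rw [integral_finsetSum]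
    · refine Finset.sum_eq_zero fun i _ => ?_
      rw [integral_const_mul]
      have h4 : ∫ y, k y * σ.t y j i ∂μ = 0 := congrFun (congrFun hz j) i
      have h5 : ∫ y, star (k y * σ.t y j i) ∂μ = star (∫ y, k y * σ.t y j i ∂μ) := integral_conj
      rw [h5, h4, star_zero, mul_zero]
    · intro i _
      refine Integrable.const_mul ?_ _
      have h6 : Integrable (fun y => k y * σ.t y j i) μ :=
        (hkL.integrable (by norm_num)).mul_bdd (c := 1)
          (σ.continuous_t_apply j i).aestronglyMeasurable
          (.of_forall fun g => σ.norm_t_apply_le g j i)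
      exact (LinearIsometryEquiv.integrable_comp_iff Complex.conjLIE).2 h6
  have hb := hpT _ (b ⟨0, σ.dim_pos⟩).2 (hTb _)
  have := b.orthonormal.ne_zero ⟨0, σ.dim_pos⟩
  exact this (Subtype.ext hb)

end PeterWeyl

/-! ### Character expansions in mean square and in the sup norm -/

namespace UnitaryIrrep

variable {G : Type*} [Group G] [TopologicalSpace G]

theorem IsRepresentativeSet.not_equivalent {I : Set (UnitaryIrrep G)}
    (hI : IsRepresentativeSet I) {ρ σ : I} (h : ρ ≠ σ) : ¬ ρ.1.Equivalent σ.1 := by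
  intro he
  obtain ⟨τ, -, hτ⟩ := hI ρ.1
  exact h (Subtype.ext ((hτ ρ.1 ⟨ρ.2, ⟨.refl _⟩⟩).trans (hτ σ.1 ⟨σ.2, he⟩).symm))

variable [IsTopologicalGroup G] [CompactSpace G]
  [T2Space G] [SecondCountableTopology G] [MeasurableSpace G] [BorelSpace G]
  (μ : Measure G) [μ.IsHaarMeasure] [IsProbabilityMeasure μ]

/-- The character as a continuous function. -/
noncomputable def charC (ρ : UnitaryIrrep G) : C(G, ℂ) := ⟨ρ.char, ρ.continuous_char⟩

/-- The character as an element of `L²(G)`. -/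
noncomputable def charL2 (ρ : UnitaryIrrep G) : Lp ℂ 2 μ := ContinuousMap.toLp 2 μ ℂ ρ.charC

theorem charL2_coeFn (ρ : UnitaryIrrep G) : ρ.charL2 μ =ᵐ[μ] ρ.char :=
  ContinuousMap.coeFn_toLp μ ρ.charC

theorem measurePreserving_conj (x : G) : MeasurePreserving (fun g => x * g * x⁻¹) μ μ := by
  have := isMulRightInvariant_of_compactSpace μ
  exact (measurePreserving_mul_right μ x⁻¹).comp (measurePreserving_mul_left μ x)

/-- The closed subspace of class functions in `L²(G)`. -/
noncomputable def classFunctions : Submodule ℂ (Lp ℂ 2 μ) :=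
  ⨅ x : G, LinearMap.ker (((Lp.compMeasurePreservingₗᵢ ℂ (fun g => x * g * x⁻¹)
    (measurePreserving_conj μ x)).toContinuousLinearMap - ContinuousLinearMap.id ℂ _ :
      Lp ℂ 2 μ →L[ℂ] Lp ℂ 2 μ) : Lp ℂ 2 μ →ₗ[ℂ] Lp ℂ 2 μ)

theorem isClosed_classFunctions : IsClosed (classFunctions μ : Set (Lp ℂ 2 μ)) := by
  rw [classFunctions, Submodule.coe_iInf]
  exact isClosed_iInter fun x => ContinuousLinearMap.isClosed_ker _

theorem mem_classFunctions {f : Lp ℂ 2 μ} :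
    f ∈ classFunctions μ ↔ ∀ x : G, (fun g => f (x * g * x⁻¹)) =ᵐ[μ] f := by
  simp only [classFunctions, Submodule.mem_iInf, LinearMap.mem_ker]
  refine forall_congr' fun x => ?_
  have h1 := Lp.coeFn_compMeasurePreserving f (measurePreserving_conj μ x)
  change Lp.compMeasurePreserving _ (measurePreserving_conj μ x) f - f = 0 ↔ _
  rw [sub_eq_zero]
  constructor
  · intro h
    rw [h] at h1
    exact h1.symm
  · intro h
    exact Lp.ext (h1.trans h)

theorem charL2_mem_classFunctions (ρ : UnitaryIrrep G) : ρ.charL2 μ ∈ classFunctions μ := by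
  rw [mem_classFunctions]
  intro x
  have h1 := (measurePreserving_conj μ x).quasiMeasurePreserving.ae (ρ.charL2_coeFn μ)
  filter_upwards [h1, ρ.charL2_coeFn μ] with g h1 h2
  rw [h1, h2, char_conj]

theorem inner_charL2_left (ρ : UnitaryIrrep G) (f : Lp ℂ 2 μ) :
    inner ℂ (ρ.charL2 μ) f = ∫ g, star (ρ.char g) * f g ∂μ := by
  rw [L2_inner_eq]
  refine integral_congr_ae ?_
  filter_upwards [ρ.charL2_coeFn μ] with g hg
  rw [hg]

theorem inner_charL2_right (ρ : UnitaryIrrep G) (f : Lp ℂ 2 μ) :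
    inner ℂ f (ρ.charL2 μ) = ∫ g, star (f g) * ρ.char g ∂μ := by
  rw [L2_inner_eq]
  refine integral_congr_ae ?_
  filter_upwards [ρ.charL2_coeFn μ] with g hg
  rw [hg]

theorem inner_charL2_charL2 (ρ σ : UnitaryIrrep G) :
    inner ℂ (σ.charL2 μ) (ρ.charL2 μ) = ∫ g, ρ.char g * star (σ.char g) ∂μ := by
  rw [inner_charL2_left]
  refine integral_congr_ae ?_
  filter_upwards [ρ.charL2_coeFn μ] with g hg
  rw [hg, mul_comm]

/-- **Peter–Weyl theorem** for class functions: the irreducible characters are a Hilbert basis of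
the space of square integrable class functions. -/
theorem exists_hilbertBasis_charL2 {I : Set (UnitaryIrrep G)} (hI : IsRepresentativeSet I) :
    ∃ b : HilbertBasis I ℂ (classFunctions μ), ∀ ρ, (b ρ : Lp ℂ 2 μ) = ρ.1.charL2 μ := by
  have : CompleteSpace (classFunctions μ) :=
    (isClosed_classFunctions μ).completeSpace_coe
  let v : I → classFunctions μ := fun ρ => ⟨ρ.1.charL2 μ, ρ.1.charL2_mem_classFunctions μ⟩
  have hv : Orthonormal ℂ v := by
    classical
    rw [orthonormal_iff_ite]
    intro ρ σ
    change inner ℂ (ρ.1.charL2 μ) (σ.1.charL2 μ) = _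
    rw [inner_charL2_charL2]
    split_ifs with h
    · subst h
      exact integral_char_mul_star_char_self μ
    · exact integral_char_mul_star_char_of_not_equivalent μ (hI.not_equivalent h)
  have hbot : (Submodule.span ℂ (Set.range v))ᗮ = ⊥ := by
    rw [Submodule.eq_bot_iff]
    intro f hf
    -- The completeness criterion pairs with `σ.char` without conjugation, whereas `inner ℂ f`
    -- conjugates `f`. It is therefore applied to `star f`.
    have hstar := Lp.coeFn_star (f : Lp ℂ 2 μ)
    have key : star (f : Lp ℂ 2 μ) = 0 := by
      refine eq_zero_of_integral_mul_char_eq_zero μ _ (fun x => ?_) fun σ => ?_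
      · have h1 := (measurePreserving_conj μ x).quasiMeasurePreserving.ae hstar
        filter_upwards [h1, hstar, (mem_classFunctions μ).1 f.2 x] with g h1 h2 h3
        rw [h1, h2, Pi.star_apply, Pi.star_apply, h3]
      · obtain ⟨ρ, ⟨hρI, hρ⟩, -⟩ := hI σ
        rw [char_eq_of_equivalent hρ]
        have h1 : inner ℂ f (v ⟨ρ, hρI⟩) = (0 : ℂ) :=
          (Submodule.mem_orthogonal' _ _).1 hf _ (Submodule.subset_span ⟨_, rfl⟩)
        change inner ℂ (f : Lp ℂ 2 μ) (ρ.charL2 μ) = (0 : ℂ) at h1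
        rw [inner_charL2_right] at h1
        rw [← h1]
        refine integral_congr_ae ?_
        filter_upwards [hstar] with g hg
        rw [hg, Pi.star_apply]
    refine Subtype.ext ((Lp.eq_zero_iff_ae_eq_zero).2 ?_)
    rw [key] at hstar
    filter_upwards [hstar, Lp.coeFn_zero ℂ 2 μ] with g h1 h2
    rw [h2, Pi.star_apply] at h1
    exact star_eq_zero.1 h1.symm
  refine ⟨HilbertBasis.mkOfOrthogonalEqBot hv hbot, fun ρ => ?_⟩
  rw [HilbertBasis.coe_mkOfOrthogonalEqBot]

/-- The character expansion of a square integrable class function. -/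
theorem hasSum_coeff_smul_charL2 {I : Set (UnitaryIrrep G)} (hI : IsRepresentativeSet I)
    {w : G → ℝ} (hw : MemLp (fun g => (w g : ℂ)) 2 μ) (hcl : ∀ g h, w (h * g * h⁻¹) = w g) :
    HasSum (fun ρ : I => ρ.1.coeff μ w • ρ.1.charL2 μ) hw.toLp := by
  obtain ⟨b, hb⟩ := exists_hilbertBasis_charL2 μ hI
  have hmem : hw.toLp ∈ classFunctions μ := by
    rw [mem_classFunctions]
    intro x
    have h1 := (measurePreserving_conj μ x).quasiMeasurePreserving.ae hw.coeFn_toLp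
    filter_upwards [h1, hw.coeFn_toLp] with g h1 h2
    rw [h1, h2, hcl]
  have h := (b.hasSum_repr ⟨_, hmem⟩).mapL (classFunctions μ).subtypeL
  change HasSum _ hw.toLp at h
  convert h using 1
  funext ρ
  rw [map_smul, b.repr_apply_apply]
  change _ = inner ℂ (b ρ : Lp ℂ 2 μ) hw.toLp • (b ρ : Lp ℂ 2 μ)
  rw [hb, inner_charL2_left]
  congr 1
  refine integral_congr_ae ?_
  filter_upwards [hw.coeFn_toLp] with g hg
  rw [hg]

/-- The character expansion may be integrated against bounded functions after composition with
a measure preserving map. -/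
theorem hasSum_integral_mul_char_comp {I : Set (UnitaryIrrep G)} (hI : IsRepresentativeSet I)
    {w : G → ℝ} (hw : MemLp (fun g => (w g : ℂ)) 2 μ) (hcl : ∀ g h, w (h * g * h⁻¹) = w g)
    {Ω : Type*} [MeasurableSpace Ω] (ν : Measure Ω)
    {φ : Ω → G} (hφ : MeasurePreserving φ ν μ) {k : Ω → ℂ} (hk : MemLp k 2 ν) :
    HasSum (fun ρ : I => ∫ x, k x * (ρ.1.coeff μ w * ρ.1.char (φ x)) ∂ν)
      (∫ x, k x * w (φ x) ∂ν) := by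
  -- The pairing `f ↦ ∫ k · (f ∘ φ)` is a continuous functional because composition with `φ` is an
  -- isometry, so it maps the `L²` expansion to a convergent series of numbers.
  let L : Lp ℂ 2 μ →L[ℂ] ℂ := (innerSL ℂ hk.star.toLp) ∘L
    (Lp.compMeasurePreservingₗᵢ ℂ φ hφ).toContinuousLinearMap
  have hL : ∀ (f : Lp ℂ 2 μ) (f' : G → ℂ), f =ᵐ[μ] f' → L f = ∫ x, k x * f' (φ x) ∂ν := by
    intro f f' hf
    change inner ℂ hk.star.toLp (Lp.compMeasurePreserving φ hφ f) = _
    rw [L2_inner_eq]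
    refine integral_congr_ae ?_
    filter_upwards [hk.star.coeFn_toLp, Lp.coeFn_compMeasurePreserving f hφ,
      hφ.quasiMeasurePreserving.ae hf] with x h1 h2 h3
    rw [h1, h2, Pi.star_apply, star_star, Function.comp_apply, h3]
  have h := (hasSum_coeff_smul_charL2 μ hI hw hcl).mapL L
  rw [hL _ _ hw.coeFn_toLp] at h
  convert h using 2 with ρ
  rw [map_smul, hL _ _ (ρ.1.charL2_coeFn μ), smul_eq_mul, ← integral_const_mul]
  refine integral_congr_ae (.of_forall fun x => ?_)
  ring

/-- Only one factor is expanded at a time. The characters already chosen are absorbed into the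
bounded function `k`, and the factors not yet expanded stay as bounded weights `w`, so each series
is an `L²` expansion paired with a bounded function. -/
theorem iteratedHasSum_integral {I : Set (UnitaryIrrep G)} (hI : IsRepresentativeSet I)
    {w : G → ℝ} (hwm : AEStronglyMeasurable w μ) {C : ℝ} (hwC : ∀ g, ‖w g‖ ≤ C)
    (hcl : ∀ g h, w (h * g * h⁻¹) = w g)
    {Ω : Type*} [MeasurableSpace Ω] (ν : Measure Ω) [IsFiniteMeasure ν] (n : ℕ) (φ : Fin n → Ω → G)
    (hφ : ∀ i, MeasurePreserving (φ i) ν μ) {k : Ω → ℂ} (hk : MemLp k ⊤ ν) :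
    IteratedHasSum n
      (fun x : Fin n → I => ∫ a, k a * ∏ i, ((x i).1.coeff μ w * (x i).1.char (φ i a)) ∂ν)
      (∫ a, k a * ∏ i, (w (φ i a) : ℂ) ∂ν) := by
  have hwb : MemLp (fun g => (w g : ℂ)) ⊤ μ :=
    memLp_top_of_bound (Complex.continuous_ofReal.comp_aestronglyMeasurable hwm) C
      (.of_forall fun g => by simpa using hwC g)
  induction n generalizing k with
  | zero => simp [IteratedHasSum]
  | succ n ih =>
    refine ⟨fun ρ => ∫ a, (k a * (ρ.1.coeff μ w * ρ.1.char (φ 0 a))) *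
      ∏ i : Fin n, (w (φ i.succ a) : ℂ) ∂ν, fun ρ => ?_, ?_⟩
    · have hχ : MemLp (fun a => ρ.1.coeff μ w * ρ.1.char (φ 0 a)) ⊤ ν := by
        have : MemLp ρ.1.char ⊤ μ := memLp_top_of_bound
          ρ.1.continuous_char.aestronglyMeasurable ρ.1.dim (.of_forall ρ.1.norm_char_le)
        exact (this.comp_measurePreserving (hφ 0)).const_mul _
      have := ih (fun i => φ i.succ) (fun i => hφ i.succ) (k := fun a =>
        k a * (ρ.1.coeff μ w * ρ.1.char (φ 0 a))) (hχ.mul hk)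
      simpa only [Fin.prod_univ_succ, Fin.cons_zero, Fin.cons_succ, mul_assoc] using this
    · have hprod : MemLp (fun a => ∏ i : Fin n, (w (φ i.succ a) : ℂ)) ⊤ ν := by
        have := MemLp.prod' (s := Finset.univ) (p := fun _ => ⊤)
          (f := fun (i : Fin n) a => (w (φ i.succ a) : ℂ)) (μ := ν)
          fun i _ => hwb.comp_measurePreserving (hφ i.succ)
        simpa using this
      have h := hasSum_integral_mul_char_comp μ hI (hwb.mono_exponent le_top) hcl ν (hφ 0)
        (k := fun a => k a * ∏ i : Fin n, (w (φ i.succ a) : ℂ))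
        ((hprod.mul (r := ⊤) hk).mono_exponent le_top)
      simp only [Fin.prod_univ_succ]
      convert h using 1
      · funext ρ
        congr 1
        funext a
        ring
      · congr 1
        funext a
        ring

/-- The character expansion of a continuous class function converges uniformly if it is
absolutely convergent. -/
theorem hasSum_coeff_smul_charC {I : Set (UnitaryIrrep G)} (hI : IsRepresentativeSet I)
    {w : G → ℝ} (hw : Continuous w) (hcl : ∀ g h, w (h * g * h⁻¹) = w g)
    (hs : Summable fun ρ : I => ‖ρ.1.coeff μ w‖ * (ρ.1.dim : ℝ)) :
    HasSum (fun ρ : I => ρ.1.coeff μ w • ρ.1.charC)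
      ⟨fun g => (w g : ℂ), Complex.continuous_ofReal.comp hw⟩ := by
  have hsum : Summable fun ρ : I => ρ.1.coeff μ w • ρ.1.charC := by
    refine Summable.of_norm_bounded hs fun ρ => ?_
    rw [norm_smul]
    refine mul_le_mul_of_nonneg_left ?_ (norm_nonneg _)
    exact (ContinuousMap.norm_le _ (by positivity)).2 ρ.1.norm_char_le
  set wc : C(G, ℂ) := ⟨fun g => (w g : ℂ), Complex.continuous_ofReal.comp hw⟩ with hwc
  have hL : MemLp (fun g => (w g : ℂ)) 2 μ :=
    wc.continuous.memLp_of_hasCompactSupport (HasCompactSupport.of_compactSpace wc)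
  have h1 := hasSum_coeff_smul_charL2 μ hI hL hcl
  have h2 := hsum.hasSum.mapL (ContinuousMap.toLp 2 μ ℂ)
  -- The uniform limit and the `L²` limit define the same class, and continuous functions that agree
  -- almost everywhere for Haar measure are equal.
  have h3 : ∑' ρ : I, ρ.1.coeff μ w • ρ.1.charC = wc := by
    apply ContinuousMap.toLp_injective (p := 2) (𝕜 := ℂ) μ
    refine h2.unique ?_
    simp only [map_smul]
    exact h1
  rw [← h3]
  exact hsum.hasSum

end UnitaryIrrep

theorem List.exists_prod_ofFn_update {M : Type*} [Monoid M] {n : ℕ} (a : Fin n → M) (j : Fin n) :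
    ∃ A B : M, ∀ x, (List.ofFn (Function.update a j x)).prod = A * x * B := by
  refine ⟨((List.ofFn a).take j).prod, ((List.ofFn a).drop (j + 1)).prod, fun x => ?_⟩
  have h : List.ofFn (Function.update a j x) = (List.ofFn a).set j x := by
    apply List.ext_getElem (by simp)
    intro i h1 h2
    rw [List.getElem_set]
    simp only [List.getElem_ofFn, Function.update_apply, Fin.ext_iff]
    simp only [eq_comm]
  rw [h, List.prod_set, if_pos (by simp)]

/-! ### Products of finitely many absolutely convergent series -/

section ProductOfSeries

variable {R ι : Type*} [NormedCommRing R] [CompleteSpace R]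

theorem hasSum_mul_of_summable_norm {κ : Type*} {u : ι → R} {v : κ → R} {s t : R}
    (hu : Summable fun j => ‖u j‖) (hv : Summable fun j => ‖v j‖) (hs : HasSum u s)
    (ht : HasSum v t) : HasSum (fun y : ι × κ => u y.1 * v y.2) (s * t) :=
  hs.mul ht (summable_mul_of_summable_norm hu hv)

/-- Absolute summability is carried along the induction because multiplying the first series with
the product of the others requires it. -/
theorem Fin.summable_norm_prod_and_hasSum (n : ℕ) (u : Fin n → ι → R) (s : Fin n → R)
    (hu : ∀ i, Summable fun j => ‖u i j‖) (hs : ∀ i, HasSum (u i) (s i)) :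
    (Summable fun x : Fin n → ι => ‖∏ i, u i (x i)‖) ∧
      HasSum (fun x : Fin n → ι => ∏ i, u i (x i)) (∏ i, s i) := by
  induction n with
  | zero =>
    refine ⟨(hasSum_unique _).summable, ?_⟩
    simp
  | succ n ih =>
    obtain ⟨h1, h2⟩ := ih (fun i => u i.succ) (fun i => s i.succ) (fun i => hu i.succ)
      (fun i => hs i.succ)
    let e : (ι × (Fin n → ι)) ≃ (Fin (n + 1) → ι) := Fin.consEquiv fun _ => ι
    have he : ∀ y : ι × (Fin n → ι), ∏ i, u i (e y i) = u 0 y.1 * ∏ i : Fin n, u i.succ (y.2 i) := by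
      intro y
      rw [Fin.prod_univ_succ]
      rfl
    have h3 := (hu 0).mul_norm h1
    constructor
    · rw [← e.summable_iff]
      simpa only [Function.comp_def, he] using h3
    · rw [← e.hasSum_iff, Fin.prod_univ_succ]
      simp only [Function.comp_def, he]
      have h5 := hasSum_mul_of_summable_norm (hu 0) h1 (hs 0) h2
      exact h5

theorem Fintype.hasSum_prod {F : Type*} [Fintype F] (u : F → ι → R) (s : F → R)
    (hu : ∀ f, Summable fun j => ‖u f j‖) (hs : ∀ f, HasSum (u f) (s f)) :
    HasSum (fun x : F → ι => ∏ f, u f (x f)) (∏ f, s f) := by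
  let e := (Fintype.equivFin F).symm
  have h := (Fin.summable_norm_prod_and_hasSum _ (fun i => u (e i)) (fun i => s (e i))
    (fun i => hu _) (fun i => hs _)).2
  rw [e.prod_comp s] at h
  rw [← (e.arrowCongr (Equiv.refl ι)).hasSum_iff]
  convert h using 1
  funext x
  rw [Function.comp_apply, ← e.prod_comp]
  simp

end ProductOfSeries

/-! ### Distribution of the holonomy -/

namespace TwoComplex

variable {V E F : Type*} (K : TwoComplex V E F) {G : Type*} [Group G] [TopologicalSpace G]
  [IsTopologicalGroup G]

theorem continuous_holonomy (f : F) : Continuous fun g : E → G => K.holonomy g f := by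
  simp only [holonomy, List.ofFn_eq_map]
  exact continuous_list_prod _ fun j _ => (continuous_apply _).zpow _

/-- Since the edge is traversed only once, translating its variable by `u` affects a single factor.
The products `A` and `B` of the other factors do not depend on `u`. -/
theorem exists_holonomy_mulSingle_mul [DecidableEq E] {f : F} {j : Fin (K.N f)}
    (hj : ∀ k : Fin (K.N f), K.bdry f k = K.bdry f j → k = j) (g : E → G) :
    ∃ A B : G, ∀ u, K.holonomy (Pi.mulSingle (K.bdry f j) u * g) f =
      A * (u * g (K.bdry f j)) ^ ((K.sign f j : ℤˣ) : ℤ) * B := by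
  obtain ⟨A, B, h⟩ := List.exists_prod_ofFn_update
    (fun j : Fin (K.N f) => g (K.bdry f j) ^ ((K.sign f j : ℤˣ) : ℤ)) j
  refine ⟨A, B, fun u => ?_⟩
  rw [← h, holonomy]
  congr 2
  funext k
  by_cases hk : k = j
  · subst hk
    simp
  · have : K.bdry f k ≠ K.bdry f j := fun h => hk (hj k h)
    simp [hk, this]

variable [CompactSpace G] [SecondCountableTopology G] [MeasurableSpace G] [BorelSpace G]
  (μ : Measure G) [μ.IsHaarMeasure] [IsProbabilityMeasure μ] [Fintype E]

/-- The holonomy along a polygon whose boundary passes through some edge exactly once is Haar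
distributed. -/
theorem measurePreserving_holonomy [DecidableEq E] {f : F} {j : Fin (K.N f)}
    (hj : ∀ k : Fin (K.N f), K.bdry f k = K.bdry f j → k = j) :
    MeasurePreserving (fun g : E → G => K.holonomy g f) (Measure.pi fun _ : E => μ) μ := by
  have hri := isMulRightInvariant_of_compactSpace μ
  have hii := isInvInvariant_of_compactSpace μ
  have hm : Measurable fun g : E → G => K.holonomy g f := (K.continuous_holonomy f).measurable
  refine ⟨hm, Measure.ext_of_lintegral _ fun φ hφ => ?_⟩
  rw [lintegral_map hφ hm]
  -- The integral does not change when the variable of the simple edge is translated by `u`, so it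
  -- may be averaged over `u`. After Tonelli the inner integral over `u` absorbs all other variables
  -- by invariance.
  have h1 : ∀ u : G, ∫⁻ g, φ (K.holonomy g f) ∂(Measure.pi fun _ : E => μ) =
      ∫⁻ g, φ (K.holonomy (Pi.mulSingle (K.bdry f j) u * g) f) ∂(Measure.pi fun _ : E => μ) :=
    fun u => (lintegral_mul_left_eq_self (μ := Measure.pi fun _ : E => μ)
      (fun g : E → G => φ (K.holonomy g f)) (Pi.mulSingle (K.bdry f j) u)).symm
  have h2 : ∀ g : E → G,
      ∫⁻ u, φ (K.holonomy (Pi.mulSingle (K.bdry f j) u * g) f) ∂μ = ∫⁻ u, φ u ∂μ := by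
    intro g
    obtain ⟨A, B, h⟩ := K.exists_holonomy_mulSingle_mul hj g
    simp only [h]
    rcases Int.units_eq_one_or (K.sign f j) with hs | hs
    · simp only [hs, Units.val_one, zpow_one]
      rw [lintegral_mul_right_eq_self (μ := μ) (fun u => φ (A * u * B)) (g (K.bdry f j)),
        lintegral_mul_left_eq_self (μ := μ) (fun u => φ (u * B)) A,
        lintegral_mul_right_eq_self (μ := μ) φ B]
    · simp only [hs, Units.val_neg, Units.val_one, zpow_neg, zpow_one]
      rw [lintegral_mul_right_eq_self (μ := μ) (fun u => φ (A * u⁻¹ * B)) (g (K.bdry f j)),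
        lintegral_inv_eq_self (μ := μ) (fun u => φ (A * u * B)),
        lintegral_mul_left_eq_self (μ := μ) (fun u => φ (u * B)) A,
        lintegral_mul_right_eq_self (μ := μ) φ B]
  calc ∫⁻ g, φ (K.holonomy g f) ∂(Measure.pi fun _ : E => μ)
      = ∫⁻ u, ∫⁻ g, φ (K.holonomy (Pi.mulSingle (K.bdry f j) u * g) f)
          ∂(Measure.pi fun _ : E => μ) ∂μ := by
        simp only [← h1, lintegral_const, measure_univ, mul_one]
    _ = ∫⁻ g, ∫⁻ u, φ (K.holonomy (Pi.mulSingle (K.bdry f j) u * g) f) ∂μ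
          ∂(Measure.pi fun _ : E => μ) := by
        refine lintegral_lintegral_swap (Measurable.aemeasurable ?_)
        refine hφ.comp (hm.comp ?_)
        refine Measurable.mul ?_ measurable_snd
        exact (measurable_pi_iff.2 fun e => by
          simp only [Pi.mulSingle_apply]
          split_ifs
          · exact measurable_fst
          · exact measurable_const)
    _ = ∫⁻ u, φ u ∂μ := by
        simp only [h2, lintegral_const, measure_univ, mul_one]

end TwoComplex

/-! ### Traces of cyclic products as sums over indices -/

theorem Fin.cons_finRotate {n : ℕ} {α : Type*} (a : α) (x : Fin n → α) (i : Fin (n + 1)) :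
    (Fin.cons a x : Fin (n + 1) → α) (finRotate (n + 1) i) = (Fin.snoc x a : Fin (n + 1) → α) i := by
  refine Fin.lastCases ?_ (fun j => ?_) i
  · simp
  · rw [finRotate_of_lt (by simp)]
    simp only [Fin.snoc_castSucc]
    exact Fin.cons_succ (α := fun _ => α) a x j

namespace Matrix

variable {R d : Type*} [CommSemiring R] [Fintype d] [DecidableEq d]

theorem list_prod_ofFn_apply (k : ℕ) (A : Fin (k + 1) → Matrix d d R) (a b : d) :
    (List.ofFn A).prod a b = ∑ n : Fin k → d, ∏ j, A j ((Fin.cons a n : Fin (k + 1) → d) j)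
      ((Fin.snoc n b : Fin (k + 1) → d) j) := by
  induction k generalizing a with
  | zero => simp [Fin.snoc]
  | succ k ih =>
    rw [List.ofFn_succ, List.prod_cons, Matrix.mul_apply,
      ← (Fin.consEquiv fun _ : Fin (k + 1) => d).sum_comp, Fintype.sum_prod_type]
    refine Finset.sum_congr rfl fun c _ => ?_
    rw [ih, Finset.mul_sum]
    refine Finset.sum_congr rfl fun n _ => ?_
    rw [Fin.prod_univ_succ (n := k + 1)]
    change _ = A 0 ((Fin.cons a (Fin.cons c n : Fin (k + 1) → d) : Fin (k + 2) → d) 0)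
      ((Fin.snoc (Fin.cons c n : Fin (k + 1) → d) b : Fin (k + 2) → d) 0) *
      ∏ i : Fin (k + 1), A i.succ
        ((Fin.cons a (Fin.cons c n : Fin (k + 1) → d) : Fin (k + 2) → d) i.succ)
        ((Fin.snoc (Fin.cons c n : Fin (k + 1) → d) b : Fin (k + 2) → d) i.succ)
    have h : (Fin.snoc (Fin.cons c n : Fin (k + 1) → d) b : Fin (k + 2) → d) =
        Fin.cons c (Fin.snoc n b : Fin (k + 1) → d) := (Fin.cons_snoc_eq_snoc_cons c n b).symm
    rw [h]
    simp only [Fin.cons_zero, Fin.cons_succ]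

theorem trace_list_prod_ofFn {N : ℕ} (hN : 0 < N) (A : Fin N → Matrix d d R) :
    (List.ofFn A).prod.trace = ∑ n : Fin N → d, ∏ j, A j (n ((finRotate N).symm j)) (n j) := by
  obtain ⟨k, rfl⟩ := Nat.exists_eq_succ_of_ne_zero hN.ne'
  rw [← (Fin.snocEquiv fun _ : Fin (k + 1) => d).sum_comp, Fintype.sum_prod_type]
  refine Finset.sum_congr rfl fun a _ => ?_
  rw [diag_apply, list_prod_ofFn_apply]
  refine Finset.sum_congr rfl fun n _ => Finset.prod_congr rfl fun j _ => ?_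
  congr 1
  -- The common end index `a` of the trace sits in the last slot of `snoc`. The row index of factor
  -- `j` is thus the index in the cyclically preceding slot.
  have := Fin.cons_finRotate a n ((finRotate (k + 1)).symm j)
  rw [Equiv.apply_symm_apply] at this
  exact this

end Matrix

/-! ### Haar averages as projectors -/

section Projector

variable {G : Type*} [Group G] [TopologicalSpace G] [IsTopologicalGroup G] [CompactSpace G]
  [MeasurableSpace G] [BorelSpace G] (μ : Measure G) [μ.IsHaarMeasure] [IsProbabilityMeasure μ]
  {ι : Type*} [Fintype ι] [DecidableEq ι]

/-- The matrix coefficients of a unitary representation integrate to the orthogonal projector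
onto the invariant vectors. -/
theorem integral_eq_sum_invariants (M : G → Matrix ι ι ℂ) (hc : Continuous M)
    (hmul : ∀ g h, M (g * h) = M g * M h) (hinv : ∀ g, M g⁻¹ = (M g).conjTranspose)
    {k : Type*} [Fintype k] (W : Submodule ℂ (EuclideanSpace ℂ ι))
    (hW : W = ⨅ g : G, LinearMap.ker (Matrix.toEuclideanLin (M g) - LinearMap.id))
    (b : OrthonormalBasis k ℂ W) (m n : ι) :
    ∫ g, M g m n ∂μ = ∑ j, (b j : EuclideanSpace ℂ ι) m * star ((b j : EuclideanSpace ℂ ι) n) := by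
  have hi : ∀ i j, Integrable (fun g => M g i j) μ := fun i j =>
    UnitaryIrrep.integrable_of_continuous μ (hc.matrix_elem i j)
  have hmem : ∀ x : EuclideanSpace ℂ ι, x ∈ W ↔ ∀ g i, ∑ j, M g i j * x j = x i := by
    intro x
    simp only [hW, Submodule.mem_iInf, LinearMap.mem_ker, LinearMap.sub_apply, sub_eq_zero,
      LinearMap.id_apply]
    refine forall_congr' fun g => ?_
    rw [← (WithLp.ofLp_injective 2).eq_iff, funext_iff]
    rfl
  -- The adjoint of the average fixes invariant vectors. This gives the coefficients, conjugates of
  -- the `n`-th components of the `b j`, in the expansion of the `n`-th column `c`, itself invariant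
  -- by left translation.
  have h1 : ∀ x ∈ W, ∀ n, ∑ m, (∫ g, M g m n ∂μ) * star (x m) = star (x n) := by
    intro x hx n
    simp only [← integral_mul_const]
    rw [← integral_finsetSum _ fun i _ => (hi i n).mul_const _]
    have : ∀ g, ∑ i, M g i n * star (x i) = star (x n) := by
      intro g
      rw [← (hmem x).1 hx g⁻¹ n, hinv, star_sum]
      refine Finset.sum_congr rfl fun i _ => ?_
      rw [star_mul', Matrix.conjTranspose_apply, star_star]
    simp only [this, integral_const, probReal_univ, one_smul]
  let c : EuclideanSpace ℂ ι := WithLp.toLp 2 fun m => ∫ g, M g m n ∂μ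
  have hcW : c ∈ W := by
    rw [hmem]
    intro g i
    change ∑ j, M g i j * ∫ h, M h j n ∂μ = ∫ h, M h i n ∂μ
    simp only [← integral_const_mul]
    rw [← integral_finsetSum _ fun j _ => (hi j n).const_mul _,
      ← integral_mul_left_eq_self (fun h => M h i n) g]
    simp only [hmul, Matrix.mul_apply]
  have h2 := congrArg (fun y : W => (y : EuclideanSpace ℂ ι) m) (b.sum_repr ⟨c, hcW⟩)
  have h3 : ∀ j, b.repr ⟨c, hcW⟩ j = star ((b j : EuclideanSpace ℂ ι) n) := by
    intro j
    rw [b.repr_apply_apply, ← h1 _ (b j).2 n]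
    change inner ℂ (b j : EuclideanSpace ℂ ι) c = _
    rw [PiLp.inner_apply]
    rfl
  simp only [h3] at h2
  change _ = ∫ g, M g m n ∂μ at h2
  rw [← h2]
  simp only [Submodule.coe_sum, Submodule.coe_smul, WithLp.ofLp_sum, WithLp.ofLp_smul,
    Finset.sum_apply, Pi.smul_apply, smul_eq_mul]
  exact Finset.sum_congr rfl fun j _ => mul_comm _ _

end Projector

/-! ### The spin foam term as an integral of characters -/

namespace TwoComplex

variable {V E F : Type*} (K : TwoComplex V E F) {G : Type*} [Group G] [TopologicalSpace G]

/-- The matrix of the factor at the passage `c` in an edge representation. -/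
noncomputable def passageMatrix (ρ : F → UnitaryIrrep G) (c : K.Position) (g : G) :
    Matrix (Fin (ρ c.1).dim) (Fin (ρ c.1).dim) ℂ :=
  if K.sign c.1 c.2 = 1 then (ρ c.1).t g else (ρ c.1).tDual g

theorem passageMatrix_mul (ρ : F → UnitaryIrrep G) (c : K.Position) (g h : G) :
    K.passageMatrix ρ c (g * h) = K.passageMatrix ρ c g * K.passageMatrix ρ c h := by
  unfold passageMatrix
  split_ifs
  · exact (ρ c.1).t_mul g h
  · rw [UnitaryIrrep.tDual, mul_inv_rev, UnitaryIrrep.t_mul, Matrix.transpose_mul]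
    rfl

theorem passageMatrix_inv (ρ : F → UnitaryIrrep G) (c : K.Position) (g : G) :
    K.passageMatrix ρ c g⁻¹ = (K.passageMatrix ρ c g).conjTranspose := by
  unfold passageMatrix
  split_ifs
  · exact (ρ c.1).t_inv g
  · rw [UnitaryIrrep.tDual, UnitaryIrrep.tDual, UnitaryIrrep.t_inv (ρ c.1) g⁻¹]
    rfl

theorem continuous_passageMatrix [IsTopologicalGroup G] (ρ : F → UnitaryIrrep G) (c : K.Position) :
    Continuous (K.passageMatrix ρ c) := by
  unfold passageMatrix
  split_ifs
  · exact (ρ c.1).continuous_t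
  · exact ((ρ c.1).continuous_t.comp continuous_inv).matrix_transpose

variable [Fintype F] [DecidableEq F] [DecidableEq E]

theorem edgeMatrix_apply (ρ : F → UnitaryIrrep G) (e : E) (g : G) (m n : K.EdgeIndex ρ e) :
    K.edgeMatrix ρ e g m n = ∏ o : K.Passage e, K.passageMatrix ρ o.1 g (m o) (n o) := by
  refine Finset.prod_congr rfl fun o _ => ?_
  unfold passageMatrix
  split_ifs <;> rfl

theorem edgeMatrix_mul (ρ : F → UnitaryIrrep G) (e : E) (g h : G) :
    K.edgeMatrix ρ e (g * h) = K.edgeMatrix ρ e g * K.edgeMatrix ρ e h := by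
  ext m n
  rw [Matrix.mul_apply]
  simp only [edgeMatrix_apply, passageMatrix_mul, Matrix.mul_apply, ← Finset.prod_mul_distrib]
  rw [Finset.prod_univ_sum, Fintype.piFinset_univ]

theorem edgeMatrix_inv (ρ : F → UnitaryIrrep G) (e : E) (g : G) :
    K.edgeMatrix ρ e g⁻¹ = (K.edgeMatrix ρ e g).conjTranspose := by
  ext m n
  simp only [Matrix.conjTranspose_apply, edgeMatrix_apply, passageMatrix_inv, star_prod]

theorem continuous_edgeMatrix [IsTopologicalGroup G] (ρ : F → UnitaryIrrep G) (e : E) :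
    Continuous (K.edgeMatrix ρ e) := by
  refine continuous_matrix fun m n => ?_
  simp only [edgeMatrix_apply]
  exact continuous_finsetProd _ fun o _ => (K.continuous_passageMatrix ρ o.1).matrix_elem _ _

/-- For sign `-1`, `t g⁻¹` is the transpose of `tDual g`, which exchanges row and column. With
either sign the row index then belongs to the end point of the edge and the column index to its
starting point. -/
theorem t_zpow_apply (ρ : F → UnitaryIrrep G) (g : G)
    (n : (c : K.Position) → Fin (ρ c.1).dim) (f : F) (j : Fin (K.N f)) :
    (ρ f).t (g ^ ((K.sign f j : ℤˣ) : ℤ)) (n ⟨f, (finRotate (K.N f)).symm j⟩) (n ⟨f, j⟩) =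
      K.passageMatrix ρ ⟨f, j⟩ g (n (K.headCorner ⟨f, j⟩)) (n (K.tailCorner ⟨f, j⟩)) := by
  have h1 : ¬ ((-1 : ℤˣ) = 1) := by decide
  let n' : Fin (K.N f) → Fin (ρ f).dim := fun j => n ⟨f, j⟩
  unfold passageMatrix headCorner tailCorner
  change (ρ f).t _ (n' _) (n' j) = (if K.sign f j = 1 then (ρ f).t g else (ρ f).tDual g)
    (n' (if K.sign f j = 1 then (finRotate (K.N f)).symm j else j))
    (n' (if K.sign f j = 1 then j else (finRotate (K.N f)).symm j))
  rcases Int.units_eq_one_or (K.sign f j) with h | h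
  · simp only [h, if_true, Units.val_one, zpow_one]
  · simp only [h, h1, if_false, Units.val_neg, Units.val_one, zpow_neg, zpow_one]
    rfl

/-- The indices at the corners at the end point of an edge. -/
def headIndex (ρ : F → UnitaryIrrep G) (n : (c : K.Position) → Fin (ρ c.1).dim) (e : E) :
    K.EdgeIndex ρ e := fun o => n (K.headCorner o.1)

/-- The indices at the corners at the starting point of an edge. -/
def tailIndex (ρ : F → UnitaryIrrep G) (n : (c : K.Position) → Fin (ρ c.1).dim) (e : E) :
    K.EdgeIndex ρ e := fun o => n (K.tailCorner o.1)

theorem char_holonomy (ρ : UnitaryIrrep G) (g : E → G) (f : F) :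
    ρ.char (K.holonomy g f) = ∑ n : Fin (K.N f) → Fin ρ.dim,
      ∏ j, ρ.t (g (K.bdry f j) ^ ((K.sign f j : ℤˣ) : ℤ)) (n ((finRotate _).symm j)) (n j) := by
  let φ : G →* Matrix (Fin ρ.dim) (Fin ρ.dim) ℂ := (Matrix.unitaryGroup _ ℂ).subtype.comp ρ.mat
  have h : ρ.t (K.holonomy g f) =
      (List.ofFn fun j => ρ.t (g (K.bdry f j) ^ ((K.sign f j : ℤˣ) : ℤ))).prod := by
    change φ _ = _
    rw [holonomy, map_list_prod, List.map_ofFn]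
    rfl
  rw [UnitaryIrrep.char, h, Matrix.trace_list_prod_ofFn (K.N_pos f)]

variable [Fintype E]

/-- The product of the characters of the holonomies as a sum over one index per corner. -/
theorem prod_char_holonomy (ρ : F → UnitaryIrrep G) (g : E → G) :
    ∏ f, (ρ f).char (K.holonomy g f) = ∑ n : (c : K.Position) → Fin (ρ c.1).dim,
      ∏ e, K.edgeMatrix ρ e (g e) (K.headIndex ρ n e) (K.tailIndex ρ n e) := by
  simp only [char_holonomy]
  rw [Finset.prod_univ_sum, Fintype.piFinset_univ,
    ← (Equiv.piCurry fun f (_ : Fin (K.N f)) => Fin (ρ f).dim).sum_comp]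
  refine Finset.sum_congr rfl fun n _ => ?_
  let φ : K.Position → ℂ := fun c => K.passageMatrix ρ c (g (K.edge c))
    (n (K.headCorner c)) (n (K.tailCorner c))
  have h : ∀ e, K.edgeMatrix ρ e (g e) (K.headIndex ρ n e) (K.tailIndex ρ n e) =
      ∏ o : K.Passage e, φ o.1 := by
    intro e
    rw [edgeMatrix_apply]
    refine Finset.prod_congr rfl fun o _ => ?_
    dsimp only [φ]
    rw [o.2]
    rfl
  refine Eq.trans ?_
    ((Finset.prod_congr rfl fun e _ => h e).trans (Fintype.prod_fiberwise K.edge φ)).symm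
  rw [Fintype.prod_sigma]
  exact Finset.prod_congr rfl fun f _ => Finset.prod_congr rfl fun j _ =>
    K.t_zpow_apply ρ _ n f j

variable [Fintype V] [DecidableEq V]

/-- Indices for all corners are the same as indices for the corners at each vertex. -/
def cornerIndexEquiv (κ : K.Position → Type*) :
    ((c : K.Position) → κ c) ≃ ((v : V) → (c : K.CornerAt v) → κ c.1) where
  toFun n _ c := n c.1
  invFun n c := n (K.cornerVertex c) ⟨c, rfl⟩
  left_inv _ := rfl
  right_inv n := by
    funext v ⟨c, hc⟩
    subst hc
    rfl

theorem prod_vertexWeight (ρ : F → UnitaryIrrep G) (x : (e : E) → K.EdgeSpace ρ e) :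
    ∏ v, K.vertexWeight ρ x v = ∑ n : (c : K.Position) → Fin (ρ c.1).dim,
      ∏ e, x e (K.headIndex ρ n e) * star (x e (K.tailIndex ρ n e)) := by
  simp only [vertexWeight]
  rw [Finset.prod_univ_sum, Fintype.piFinset_univ,
    ← (K.cornerIndexEquiv fun c => Fin (ρ c.1).dim).sum_comp]
  refine Finset.sum_congr rfl fun n _ => ?_
  rw [Finset.prod_mul_distrib, Finset.prod_mul_distrib]
  congr 1
  · exact Fintype.prod_fiberwise K.head fun e => x e (K.headIndex ρ n e)
  · exact Fintype.prod_fiberwise K.tail fun e => star (x e (K.tailIndex ρ n e))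

variable [IsTopologicalGroup G] [CompactSpace G] [SecondCountableTopology G]
  [MeasurableSpace G] [BorelSpace G] (μ : Measure G) [μ.IsHaarMeasure] [IsProbabilityMeasure μ]

theorem sum_prod_vertexWeight_eq_integral (ρ : F → UnitaryIrrep G) {k : E → Type*}
    [∀ e, Fintype (k e)] (b : (e : E) → OrthonormalBasis (k e) ℂ (K.edgeInvariants ρ e)) :
    ∑ j : (e : E) → k e, ∏ v, K.vertexWeight ρ (fun e => (b e (j e) : K.EdgeSpace ρ e)) v =
      ∫ g : E → G, ∏ f, (ρ f).char (K.holonomy g f) ∂(Measure.pi fun _ : E => μ) := by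
  classical
  simp only [prod_vertexWeight, prod_char_holonomy]
  -- For fixed corner indices both sides factor over the edges: the sum over `j` by distributivity,
  -- the integral by Fubini.
  rw [Finset.sum_comm, integral_finsetSum]
  · refine Finset.sum_congr rfl fun n _ => ?_
    rw [integral_fintype_prod_eq_prod (fun e g => K.edgeMatrix ρ e g
      (K.headIndex ρ n e) (K.tailIndex ρ n e))]
    have h := Finset.prod_univ_sum (fun _ => Finset.univ) (fun (e : E) (j : k e) =>
      (b e j : K.EdgeSpace ρ e) (K.headIndex ρ n e) *
        star ((b e j : K.EdgeSpace ρ e) (K.tailIndex ρ n e)))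
    rw [Fintype.piFinset_univ] at h
    rw [← h]
    refine Finset.prod_congr rfl fun e _ => ?_
    exact (integral_eq_sum_invariants μ (K.edgeMatrix ρ e)
      (K.continuous_edgeMatrix _ e) (K.edgeMatrix_mul _ e) (K.edgeMatrix_inv _ e) _ rfl
      (b e) _ _).symm
  · intro n _
    refine Integrable.fintype_prod (f := fun e g => K.edgeMatrix ρ e g
      (K.headIndex ρ n e) (K.tailIndex ρ n e)) fun e => ?_
    exact UnitaryIrrep.integrable_of_continuous μ
      ((K.continuous_edgeMatrix ρ e).matrix_elem (K.headIndex ρ n e) (K.tailIndex ρ n e))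

/-- The contribution of a labelling to the spin foam sum is the integral of the corresponding
product of characters. -/
theorem spinFoamTerm_eq_integral (w : G → ℝ) {I : Set (UnitaryIrrep G)} (P : K.ProjectorBases I)
    (ρ : F → I) :
    K.spinFoamTerm μ w P ρ = ∫ g : E → G, ∏ f, ((ρ f).1.coeff μ w *
      (ρ f).1.char (K.holonomy g f)) ∂(Measure.pi fun _ : E => μ) := by
  simp only [Finset.prod_mul_distrib, integral_const_mul]
  rw [← K.sum_prod_vertexWeight_eq_integral μ (fun f => (ρ f).1) (P ρ), Finset.mul_sum]
  rfl

end TwoComplex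

/-! ### Convergence to the partition function -/

namespace TwoComplex

variable {V E F : Type*} (K : TwoComplex V E F) {G : Type*} [Group G] [TopologicalSpace G]
  [IsTopologicalGroup G] [CompactSpace G] [T2Space G] [SecondCountableTopology G]
  [MeasurableSpace G] [BorelSpace G] (μ : Measure G) [μ.IsHaarMeasure] [IsProbabilityMeasure μ]
  [Fintype E] [Fintype F]

theorem ofReal_partitionFunction (w : G → ℝ) :
    (K.partitionFunction μ w : ℂ) =
      ∫ g : E → G, ∏ f, (w (K.holonomy g f) : ℂ) ∂(Measure.pi fun _ : E => μ) := by
  simp only [← Complex.ofReal_prod]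
  exact integral_ofReal.symm

theorem iteratedHasSum_partitionFunction [DecidableEq E] (hK : K.EveryPolygonHasSimpleEdge)
    {I : Set (UnitaryIrrep G)} (hI : UnitaryIrrep.IsRepresentativeSet I)
    {w : G → ℝ} (hwm : AEStronglyMeasurable w μ) {C : ℝ} (hwC : ∀ g, ‖w g‖ ≤ C)
    (hcl : ∀ g h, w (h * g * h⁻¹) = w g) {n : ℕ} (order : Fin n ≃ F) :
    IteratedHasSum n
      (fun x : Fin n → I => ∫ g : E → G, ∏ f, ((x (order.symm f)).1.coeff μ w *
        (x (order.symm f)).1.char (K.holonomy g f)) ∂(Measure.pi fun _ : E => μ))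
      (K.partitionFunction μ w : ℂ) := by
  have h := UnitaryIrrep.iteratedHasSum_integral μ hI hwm hwC hcl (Measure.pi fun _ : E => μ) n
    (fun i g => K.holonomy g (order i))
    (fun i => (hK (order i)).elim fun j hj => K.measurePreserving_holonomy μ hj)
    (k := fun _ => 1) (memLp_const 1)
  simp only [one_mul] at h
  rw [K.ofReal_partitionFunction μ w]
  convert h using 1
  · funext x
    congr 1
    funext g
    rw [← order.prod_comp]
    simp
  · congr 1
    funext g
    rw [← order.prod_comp]

theorem hasSum_partitionFunction {I : Set (UnitaryIrrep G)}
    (hI : UnitaryIrrep.IsRepresentativeSet I) {w : G → ℝ} (hw : Continuous w)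
    (hcl : ∀ g h, w (h * g * h⁻¹) = w g)
    (hs : Summable fun ρ : I => ‖ρ.1.coeff μ w‖ * (ρ.1.dim : ℝ)) :
    HasSum (fun ρ : F → I => ∫ g : E → G, ∏ f, ((ρ f).1.coeff μ w *
        (ρ f).1.char (K.holonomy g f)) ∂(Measure.pi fun _ : E => μ))
      (K.partitionFunction μ w : ℂ) := by
  let hol : F → C(E → G, G) := fun f => ⟨fun g => K.holonomy g f, K.continuous_holonomy f⟩
  let u : F → I → C(E → G, ℂ) := fun f ρ => (ρ.1.coeff μ w • ρ.1.charC).comp (hol f)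
  have hu : ∀ f, Summable fun ρ => ‖u f ρ‖ := fun f => by
    refine Summable.of_nonneg_of_le (fun _ => norm_nonneg _) (fun ρ => ?_) hs
    refine (ContinuousMap.norm_le _ (by positivity)).2 fun g => ?_
    exact (norm_mul_le _ _).trans
      (mul_le_mul_of_nonneg_left (ρ.1.norm_char_le _) (norm_nonneg _))
  have hsum : ∀ f, HasSum (u f) ((⟨fun g => (w g : ℂ), Complex.continuous_ofReal.comp hw⟩ :
      C(G, ℂ)).comp (hol f)) := fun f => by
    have h := UnitaryIrrep.hasSum_coeff_smul_charC μ hI hw hcl hs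
    exact h.mapL (ContinuousMap.compRightAlgHom ℂ ℂ (hol f) |>.toLinearMap.mkContinuous 1
      fun φ => by
        rw [one_mul]
        exact (ContinuousMap.norm_le _ (norm_nonneg _)).2 fun g => φ.norm_coe_le_norm _)
  have h := Fintype.hasSum_prod u _ hu hsum
  have hint : ∀ φ : C(E → G, ℂ), Integrable φ (Measure.pi fun _ : E => μ) := fun φ =>
    φ.continuous.integrable_of_hasCompactSupport (HasCompactSupport.of_compactSpace φ)
  let L : C(E → G, ℂ) →L[ℂ] ℂ := LinearMap.mkContinuous
    { toFun := fun φ => ∫ g, φ g ∂(Measure.pi fun _ : E => μ)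
      map_add' := fun φ ψ => integral_add (hint φ) (hint ψ)
      map_smul' := fun c φ => integral_const_mul c φ } 1 fun φ => by
    rw [one_mul]
    have := norm_integral_le_of_norm_le_const (μ := Measure.pi fun _ : E => μ)
      (.of_forall φ.norm_coe_le_norm)
    simpa using this
  have hL := h.mapL L
  rw [K.ofReal_partitionFunction μ w]
  convert hL using 1
  · funext ρ
    change _ = ∫ g, _ ∂_
    congr 1
    funext g
    rw [ContinuousMap.prod_apply]
    rfl
  · change _ = ∫ g, _ ∂_
    congr 1
    funext g
    rw [ContinuousMap.prod_apply]
    rfl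

end TwoComplex

theorem mainTheorem3 {V E F G : Type*}
    [Fintype V] [DecidableEq V] [Fintype E] [DecidableEq E] [Fintype F] [DecidableEq F]
    (K : TwoComplex V E F)
    [Group G] [TopologicalSpace G] [IsTopologicalGroup G] [CompactSpace G] [T2Space G]
    [SecondCountableTopology G] [MeasurableSpace G] [BorelSpace G]
    (μ : Measure G) [μ.IsHaarMeasure] [IsProbabilityMeasure μ]
    (s : G → ℝ) (hs_bdd : ∃ C : ℝ, ∀ g, |s g| ≤ C) (hs_L2 : MemLp s 2 μ)
    (hs_class : ∀ g h, s (h * g * h⁻¹) = s g)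
    (I : Set (UnitaryIrrep G)) (hI : UnitaryIrrep.IsRepresentativeSet I)
    (P : K.ProjectorBases I) :
    (K.EveryPolygonHasSimpleEdge →
      ∀ order : Fin (Fintype.card F) ≃ F,
        IteratedHasSum (Fintype.card F)
          (fun x : Fin (Fintype.card F) → I =>
            K.spinFoamTerm μ (boltzmannWeight s) P (fun f => x (order.symm f)))
          (K.partitionFunction μ (boltzmannWeight s) : ℂ)) ∧
    (Continuous s →
      Summable (fun ρ : I => ‖ρ.1.coeff μ (boltzmannWeight s)‖ * (ρ.1.dim : ℝ)) →
      HasSum (fun ρ : F → I => K.spinFoamTerm μ (boltzmannWeight s) P ρ)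
        (K.partitionFunction μ (boltzmannWeight s) : ℂ)) := by
  have hcl : ∀ g h, boltzmannWeight s (h * g * h⁻¹) = boltzmannWeight s g := fun g h => by
    rw [boltzmannWeight, hs_class, boltzmannWeight]
  -- Here the chosen bases disappear: the remaining claims concern integrals of characters only.
  simp only [K.spinFoamTerm_eq_integral μ]
  refine ⟨fun hK order => ?_, fun hc hs => ?_⟩
  · obtain ⟨C, hC⟩ := hs_bdd
    refine K.iteratedHasSum_partitionFunction μ hK hI
      (Real.continuous_exp.comp_aestronglyMeasurable hs_L2.1.neg) (C := Real.exp C)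
      (fun g => ?_) hcl order
    change ‖Real.exp (-s g)‖ ≤ _
    rw [Real.norm_eq_abs, Real.abs_exp]
    exact Real.exp_le_exp.2 ((neg_le_abs _).trans (hC g))
  · exact K.hasSum_partitionFunction μ hI (Real.continuous_exp.comp hc.neg) hcl hs
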